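/- There are universal positive constants \(c_1,c_2,c_3\) such that the following holds for all \(d\ge c_1\), all \(m\) and all \(r\ge 0\). Let \(\psi:\mathbb R\to[-1,1]\) be periodic with period \(1\) and of bounded variation on every finite interval. Let \(\varepsilon:[0,\infty)\to[0,1]\) be any function. Let \(\varphi^2\) be a probability density on \(\mathbb R^d\) that is a finite or countably infinite mixture \(\varphi^2=\sum_i\alpha_i\varphi_i^2\) (\(\alpha_i\ge 0\), \(\sum_i\alpha_i=1\)) of probability densities \(\varphi_i^2\), where each \(\varphi_i^2\) is \(\varepsilon(r)\) Fourier-concentrated: \(\varphi_i\) is a real function in \(L^2(\mathbb R^d)\) whose Fourier transform (with \(\hat h(\mathbf w)=\int e^{-2\pi i\langle \mathbf x,\mathbf w\rangle}h(\mathbf x)\,d\mathbf x\), extended to \(L^2\)) satisfies \(\|\hat\varphi_i\,\mathbf 1_{\{\|\mathbf x\|\ge s\}}\|_{L^2}\le\varepsilon(s)\,\|\hat\varphi_i\|_{L^2}\) for every \(s\ge 0\). Let \(\mathcal W\subseteq\mathbb R^m\), and for every \(\mathbf v\in\mathcal W\) let \(f(\mathbf v,\cdot):\mathbb R^d\to\mathbb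 R\) satisfy \(\mathbb E_{\mathbf x\sim\varphi^2}f(\mathbf v,\mathbf x)^2<\infty\). Let \(\mathbf w\) be an interior point of \(\mathcal W\) such that \(f(\cdot,\mathbf x)\) is differentiable at \(\mathbf w\) for \(\varphi^2\)-almost every \(\mathbf x\), such that for some \(K\) we have \(\mathbb E_{\mathbf x\sim\varphi^2}(f(\mathbf v,\mathbf x)-f(\mathbf w,\mathbf x))^2\le K\|\mathbf v-\mathbf w\|^2\) for all \(\mathbf v\) near \(\mathbf w\), and such that \(\mathbb E_{\mathbf x\sim\varphi^2}\big\|\tfrac{\partial}{\partial\mathbf w}f(\mathbf w,\mathbf x)\big\|^2\le G_{\mathbf w}\), where \(G_{\mathbf w}<\infty\). For \(\mathbf w^\star\in\mathbb R^d\) put \[F_{\mathbf w^\star}(\mathbf v)=\mathbb E_{\mathbf x\sim\varphi^2}\big[(f(\mathbf v,\mathbf x)-\psi(\langle\mathbf w^\star,\mathbf x\rangle))^2\big].\] Then every \(F_{\mathbf w^\star}\) is differentiable at \(\mathbf w\), and if \(\mathbf w^\star\) is uniformly distributed on the sphere \(\{\|\mathbf w^\star\|=2r\}\subset\mathbb R^d\),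 then \(\nabla F_{\mathbf w^\star}(\mathbf w)\) is integrable and \[\operatorname{Var}_{\mathbf w^\star}\big(\nabla F_{\mathbf w^\star}(\mathbf w)\big):=\mathbb E_{\mathbf w^\star}\big\|\nabla F_{\mathbf w^\star}(\mathbf w)-\mathbb E_{\mathbf w^\star}[\nabla F_{\mathbf w^\star}(\mathbf w)]\big\|^2\le c_2\,G_{\mathbf w}\Big(\exp(-c_3d)+\sum_{n=1}^{\infty}\varepsilon(nr)\Big),\] with the convention \(0\cdot\infty=0\) on the right-hand side. -/

import Mathlib

open MeasureTheory Filter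
open scoped FourierTransform Topology NNReal ENNReal

noncomputable section

/-- `p` is a probability density with respect to Lebesgue measure on `ℝ^d`. -/
def IsProbDensity {d : ℕ} (p : EuclideanSpace ℝ (Fin d) → ℝ) : Prop :=
  (∀ x, 0 ≤ p x) ∧ Integrable p volume ∧ ∫ x, p x = 1

/-- The function `φ` belongs to `L²(ℝ^d)`, and for every `r ≥ 0` its (`L²`, or Plancherel) Fourier
transform satisfies `‖φ̂ · 1_{‖x‖ ≥ r}‖ ≤ ‖φ̂‖ ε(r)`; that is, the function `φ²`, with square
root `φ`, is `ε(r)` Fourier-concentrated. -/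
def FourierConcentrated {d : ℕ} (ε : ℝ → ℝ) (φ : EuclideanSpace ℝ (Fin d) → ℝ) : Prop :=
  ∃ h : MemLp (fun x => (φ x : ℂ)) 2 (volume : Measure (EuclideanSpace ℝ (Fin d))),
    ∀ r : ℝ, 0 ≤ r →
      eLpNorm (Set.indicator {x : EuclideanSpace ℝ (Fin d) | r ≤ ‖x‖}
          (𝓕 (h.toLp (fun x => (φ x : ℂ))) :
            Lp ℂ 2 (volume : Measure (EuclideanSpace ℝ (Fin d))))) 2 volume
        ≤ eLpNorm (𝓕 (h.toLp (fun x => (φ x : ℂ))) :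
            Lp ℂ 2 (volume : Measure (EuclideanSpace ℝ (Fin d)))) 2 volume * ENNReal.ofReal (ε r)

/-- `φ² = ∑ᵢ αᵢ φᵢ²` is a density which is a (finite or countably infinite) mixture of
`ε(r)` Fourier-concentrated densities `φᵢ²`. -/
structure IsFourierMixture {d : ℕ} {ι : Type} (ε : ℝ → ℝ) (φ : EuclideanSpace ℝ (Fin d) → ℝ)
    (α : ι → ℝ) (φs : ι → EuclideanSpace ℝ (Fin d) → ℝ) : Prop where
  countable : Countable ι
  density : IsProbDensity (fun x => φ x ^ 2)
  weight_nonneg : ∀ i, 0 ≤ α i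
  weight_sum : HasSum α 1
  density_component : ∀ i, IsProbDensity (fun x => φs i x ^ 2)
  concentrated : ∀ i, FourierConcentrated ε (φs i)
  mixture : ∀ᵐ x, HasSum (fun i => α i * φs i x ^ 2) (φ x ^ 2)

/-- The probability distribution on `ℝ^d` with density `φ²`. -/
def sqDensityMeasure {d : ℕ} (φ : EuclideanSpace ℝ (Fin d) → ℝ) :
    Measure (EuclideanSpace ℝ (Fin d)) :=
  volume.withDensity (fun x => ENNReal.ofReal (φ x ^ 2))

/-- The uniform probability distribution on the sphere of radius `ρ` centred at the origin of
`ℝ^d`: the normalised surface measure of the unit sphere, scaled by `ρ`. -/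
def uniformSphere (d : ℕ) (ρ : ℝ) : Measure (EuclideanSpace ℝ (Fin d)) :=
  (((volume : Measure (EuclideanSpace ℝ (Fin d))).toSphere Set.univ)⁻¹ •
      (volume : Measure (EuclideanSpace ℝ (Fin d))).toSphere).map
    (fun u : Metric.sphere (0 : EuclideanSpace ℝ (Fin d)) 1 =>
      ρ • (u : EuclideanSpace ℝ (Fin d)))

/-- The objective `F_{w⋆}(w) = E_{x ∼ φ²} (f(w, x) - ψ(⟨w⋆, x⟩))²`. -/
def objective {d m : ℕ} (φ : EuclideanSpace ℝ (Fin d) → ℝ) (ψ : ℝ → ℝ)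
    (f : EuclideanSpace ℝ (Fin m) → EuclideanSpace ℝ (Fin d) → ℝ)
    (wstar : EuclideanSpace ℝ (Fin d)) (w : EuclideanSpace ℝ (Fin m)) : ℝ :=
  ∫ x, (f w x - ψ (inner ℝ wstar x)) ^ 2 ∂(sqDensityMeasure φ)

end

/-!
The gradient of the objective at `w` is `2 ∫ (f w x - ψ ⟪w⋆, x⟫) g x dμ`, where `μ` is the
distribution with density `φ²` and `g x` is the gradient of `f · x` at `w`
(`hasGradientAt_integral_sub_sq`; the remainders of the first-order expansions are bounded in `L²`
and tend to `0` almost everywhere, hence weakly). So, up to a vector that does not depend on `w⋆`,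
it is `-2` times the correlation `V w⋆ = ∫ (ψ ⟪w⋆, x⟫ - c) g x dμ`, where `c` is the mean of `ψ`
over a period, and it suffices to bound the second moment of `V`. By Jensen's inequality over the
mixture, and coordinate by coordinate, one may take a single density `φ²` with `φ̂` concentrated and
a real function `g`.

For one component the correlation is the `L²` pairing of `g φ` with `(ψ ⟪w⋆, ·⟫ - c) φ`. Split `φ`
at frequency `r`. The high-frequency part has norm at most `ε r`, and multiplication by `ψ - c`
at most doubles it. The low-frequency part, multiplied by a mean-zero periodic function of `⟪w⋆, x⟫`, has
its frequencies in the balls of radius `r` about the nonzero multiples of `w⋆`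
(`integral_conj_mul_mul_comp_inner_eq_zero`), so it only sees the part of the Fourier transform of
`g φ` in this `frequencyTube`. Since `‖w⋆‖ = 2r`, every point of the tube makes an angle of at most
`30°` with the line of `w⋆`, so a fixed frequency lies in the tube of a random `w⋆` with
exponentially small probability (`uniformSphere_mem_frequencyTube_le`), and by Tonelli's theorem the
tube catches on average an exponentially small fraction of the mass of the transform.

The argument bounds the variance by a multiple of `G * (exp (-c₃ d) + ε r ^ 2)`, and `ε r ^ 2` is at
most the first term of the series. Bounded variation of `ψ` only enters through measurability.
-/

/-! ### Multiplication operators and translations on `L²` -/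

/-- Multiplication by a bounded measurable function, as a bounded operator on `L²`. -/
theorem exists_mulCLM {X : Type*} [MeasurableSpace X] {μ : Measure X} {b : X → ℂ}
    (hb : AEStronglyMeasurable b μ) {C : ℝ} (hC : ∀ x, ‖b x‖ ≤ C) :
    ∃ M : Lp ℂ 2 μ →L[ℂ] Lp ℂ 2 μ, (∀ u, M u =ᵐ[μ] fun x => b x * u x) ∧
      ∀ u, ‖M u‖ ≤ C * ‖u‖ := by
  have hmem : MemLp b ∞ μ := memLp_top_of_bound hb C (Eventually.of_forall hC)
  have hM : ∀ u : Lp ℂ 2 μ,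
      (ContinuousLinearMap.mul ℂ ℂ).holderL μ ∞ 2 2 (hmem.toLp b) u =ᵐ[μ] fun x => b x * u x := by
    intro u
    filter_upwards [(ContinuousLinearMap.mul ℂ ℂ).coeFn_holder (r := 2) (hmem.toLp b) u,
      hmem.coeFn_toLp] with x h1 h2
    refine h1.trans ?_
    simp [h2]
  refine ⟨(ContinuousLinearMap.mul ℂ ℂ).holderL μ ∞ 2 2 (hmem.toLp b), hM, fun u => ?_⟩
  refine Lp.norm_le_mul_norm_of_ae_le_mul ?_
  filter_upwards [hM u] with x hx
  rw [hx, norm_mul]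
  exact mul_le_mul_of_nonneg_right (hC x) (norm_nonneg _)

section Fourier

variable {E : Type*} [NormedAddCommGroup E] [InnerProductSpace ℝ E] [FiniteDimensional ℝ E]
  [MeasurableSpace E] [BorelSpace E]

theorem SchwartzMap.fourierInv_compSubConst_fourier (f : SchwartzMap E ℂ) (ξ x : E) :
    (𝓕⁻ ((𝓕 f).compSubConstCLM ℂ ξ) : SchwartzMap E ℂ) x =
      (Real.fourierChar (inner ℝ ξ x) : Circle) * f x := by
  have h1 : 𝓕⁻ (𝓕 f) = f := by simp
  conv_rhs => rw [← h1]
  rw [SchwartzMap.fourierInv_coe, SchwartzMap.fourierInv_coe, Real.fourierInv_eq,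
    Real.fourierInv_eq, ← integral_const_mul, ← integral_add_right_eq_self _ ξ]
  congr 1
  ext v
  simp only [SchwartzMap.compSubConstCLM_apply, add_sub_cancel_right, inner_add_left,
    AddChar.map_add_eq_mul, Circle.smul_def, Circle.coe_mul, smul_eq_mul]
  ring

/-- On `L²`, the inverse Fourier transform turns the translation by `ξ` into the modulation by the
character `x ↦ 𝐞 ⟪ξ, x⟫`. -/
theorem fourierInv_translate_fourier (ξ : E) (Φ : Lp ℂ 2 (volume : Measure E)) :
    (𝓕⁻ (Lp.compMeasurePreserving (fun y => y - ξ) (measurePreserving_sub_right volume ξ) (𝓕 Φ)) :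
      Lp ℂ 2 (volume : Measure E)) =ᵐ[volume]
        fun x => (Real.fourierChar (inner ℝ ξ x) : Circle) * Φ x := by
  obtain ⟨M, hM, -⟩ := exists_mulCLM (μ := (volume : Measure E))
    (b := fun x => ((Real.fourierChar (inner ℝ ξ x) : Circle) : ℂ)) (C := 1)
    (by
      refine Continuous.aestronglyMeasurable ?_
      have := Real.continuous_fourierChar
      fun_prop) (fun x => (Circle.norm_coe _).le)
  suffices h : 𝓕⁻ (Lp.compMeasurePreserving (fun y => y - ξ)
      (measurePreserving_sub_right volume ξ) (𝓕 Φ)) = M Φ by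
    rw [h]; exact hM Φ
  apply DenseRange.induction_on (p := fun Φ : Lp ℂ 2 (volume : Measure E) =>
    𝓕⁻ (Lp.compMeasurePreserving (fun y => y - ξ)
      (measurePreserving_sub_right volume ξ) (𝓕 Φ)) = M Φ)
    (SchwartzMap.denseRange_toLpCLM (p := 2) (F := ℂ) ENNReal.ofNat_ne_top) Φ
  · refine isClosed_eq ?_ M.continuous
    exact (Lp.fourierTransformₗᵢ E ℂ).symm.continuous.comp
      ((Lp.isometry_compMeasurePreserving _).continuous.comp
        (Lp.fourierTransformₗᵢ E ℂ).continuous)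
  intro f
  rw [SchwartzMap.toLpCLM_apply, SchwartzMap.toLp_fourier_eq]
  have h1 : Lp.compMeasurePreserving (fun y => y - ξ) (measurePreserving_sub_right volume ξ)
      ((𝓕 f).toLp 2) = ((𝓕 f).compSubConstCLM ℂ ξ).toLp 2 := by
    apply Lp.ext
    refine (Lp.coeFn_compMeasurePreserving _ _).trans ?_
    refine ((measurePreserving_sub_right (volume : Measure E) ξ).quasiMeasurePreserving.ae_eq_comp
      (SchwartzMap.coeFn_toLp (𝓕 f) 2 volume)).trans ?_
    exact (SchwartzMap.coeFn_toLp ((𝓕 f).compSubConstCLM ℂ ξ) 2 volume).symm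
  rw [h1, SchwartzMap.toLp_fourierInv_eq]
  apply Lp.ext
  filter_upwards [SchwartzMap.coeFn_toLp (𝓕⁻ ((𝓕 f).compSubConstCLM ℂ ξ)) 2 volume,
    hM (f.toLp 2), SchwartzMap.coeFn_toLp f 2 volume] with x h1 h2 h3
  rw [h1, h2, h3, SchwartzMap.fourierInv_compSubConst_fourier]

/-- If `Φ̂` is supported in the ball of radius `r` about `0` and `V̂` vanishes on the ball of radius
`r` about `ξ`, then `V` is orthogonal to the modulation of `Φ` by the character of frequency
`ξ`. -/
theorem integral_conj_mul_char_mul_eq_zero (V Φ : Lp ℂ 2 (volume : Measure E)) (ξ : E) (r : ℝ)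
    (hΦ : ∀ᵐ y, r ≤ ‖y‖ → (𝓕 Φ : Lp ℂ 2 (volume : Measure E)) y = 0)
    (hV : ∀ᵐ y, ‖y - ξ‖ < r → (𝓕 V : Lp ℂ 2 (volume : Measure E)) y = 0) :
    ∫ x, (starRingEnd ℂ (V x)) * Φ x * (Real.fourierChar (inner ℝ ξ x) : Circle) = 0 := by
  set T := Lp.compMeasurePreserving (fun y => y - ξ) (measurePreserving_sub_right volume ξ) (𝓕 Φ)
    with hT
  have h1 : inner ℂ V (𝓕⁻ T) =
      ∫ x, (starRingEnd ℂ (V x)) * Φ x * (Real.fourierChar (inner ℝ ξ x) : Circle) := by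
    rw [L2.inner_def]
    refine integral_congr_ae ?_
    filter_upwards [fourierInv_translate_fourier ξ Φ] with x hx
    rw [RCLike.inner_apply, hx]
    ring
  rw [← h1, ← Lp.inner_fourier_eq, FourierTransform.fourier_fourierInv_eq, L2.inner_def]
  refine integral_eq_zero_of_ae ?_
  have hq := (measurePreserving_sub_right (volume : Measure E) ξ).quasiMeasurePreserving.ae hΦ
  filter_upwards [hV, hq, Lp.coeFn_compMeasurePreserving (𝓕 Φ)
    (measurePreserving_sub_right (volume : Measure E) ξ)] with y h2 h3 h4
  rw [RCLike.inner_apply, hT, h4, Function.comp_apply, Pi.zero_apply]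
  rcases lt_or_ge ‖y - ξ‖ r with h | h
  · simp [h2 h]
  · simp [h3 h]

end Fourier

/-! ### Integrals against periodic functions -/

/-- The function on the circle `ℝ / ℤ` with the same values as `ψ` on `[0, 1)`. -/
noncomputable def circleFun (ψ : ℝ → ℝ) (z : UnitAddCircle) : ℝ :=
  ψ (AddCircle.measurableEquivIco 1 0 z)

theorem measurable_circleFun {ψ : ℝ → ℝ} (hψ : Measurable ψ) : Measurable (circleFun ψ) :=
  hψ.comp (measurable_subtype_coe.comp (AddCircle.measurableEquivIco 1 0).measurable)

theorem circleFun_coe {ψ : ℝ → ℝ} (hper : Function.Periodic ψ 1) (t : ℝ) :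
    circleFun ψ (t : UnitAddCircle) = ψ t := by
  have h : (((AddCircle.measurableEquivIco 1 0 (t : UnitAddCircle) : ℝ)) : UnitAddCircle) = t :=
    (AddCircle.equivIco 1 0).symm_apply_apply (t : UnitAddCircle)
  have h2 : hper.lift (((AddCircle.measurableEquivIco 1 0 (t : UnitAddCircle) : ℝ)) :
    UnitAddCircle) = hper.lift (t : UnitAddCircle) := by rw [h]
  simpa [circleFun] using h2

/-- The mean of a `1`-periodic function over a period. -/
noncomputable def periodMean (ψ : ℝ → ℝ) : ℝ :=
  ∫ z, circleFun ψ z ∂(AddCircle.haarAddCircle : Measure UnitAddCircle)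

theorem abs_periodMean_le {ψ : ℝ → ℝ} (hb : ∀ t, |ψ t| ≤ 1) : |periodMean ψ| ≤ 1 := by
  have := norm_integral_le_of_norm_le_const
    (μ := (AddCircle.haarAddCircle : Measure UnitAddCircle)) (f := circleFun ψ) (C := 1)
    (Eventually.of_forall fun z => hb _)
  simpa [periodMean] using this

/-- The Fourier uniqueness argument on the circle: if all the nonzero Fourier coefficients of the
image under `T` of the complex measure `q dμ` vanish, then this image is a multiple of Haar measure,
so that mean-zero periodic functions integrate to zero against it. -/
theorem integral_comp_periodic_sub_mean_eq_zero {X : Type*} [MeasurableSpace X] {μ : Measure X}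
    {q : X → ℂ} (hq : Integrable q μ) {T : X → ℝ} (hT : Measurable T) {ψ : ℝ → ℝ}
    (hψ : Measurable ψ) (hb : ∀ t, |ψ t| ≤ 1) (hper : Function.Periodic ψ 1)
    (h : ∀ k : ℤ, k ≠ 0 → ∫ x, q x * (Real.fourierChar (k * T x) : Circle) ∂μ = 0) :
    ∫ x, q x * ((ψ (T x) - periodMean ψ : ℝ) : ℂ) ∂μ = 0 := by
  set S : X → UnitAddCircle := fun x => (T x : UnitAddCircle) with hS
  have hSm : Measurable S := AddCircle.measurable_mk'.comp hT
  set κ : Measure UnitAddCircle := AddCircle.haarAddCircle with hκ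
  set ρ : Measure UnitAddCircle := (μ.withDensity fun x => ‖q x‖ₑ).map S with hρ
  have hfin : IsFiniteMeasure (μ.withDensity fun x => ‖q x‖ₑ) :=
    isFiniteMeasure_withDensity hq.2.ne
  have hρfin : IsFiniteMeasure ρ := by rw [hρ]; infer_instance
  set Q : ℝ := ∫ x, ‖q x‖ ∂μ with hQ
  have hQ0 : 0 ≤ Q := integral_nonneg fun x => norm_nonneg _
  -- the defect between integrating against the image measure and against Haar measure
  set Λ : (UnitAddCircle → ℂ) → ℂ := fun b =>
    ∫ x, q x * b (S x) ∂μ - (∫ z, b z ∂κ) * ∫ x, q x ∂μ with hΛ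
  have hint : ∀ b : UnitAddCircle → ℂ, Measurable b → (∃ C, ∀ z, ‖b z‖ ≤ C) →
      Integrable (fun x => q x * b (S x)) μ := by
    rintro b hbm ⟨C, hC⟩
    exact hq.mul_bdd (c := C) (hbm.comp hSm).aestronglyMeasurable
      (Eventually.of_forall fun x => hC _)
  have hint' : ∀ (ν : Measure UnitAddCircle) [IsFiniteMeasure ν] (b : UnitAddCircle → ℂ),
      Measurable b → (∃ C, ∀ z, ‖b z‖ ≤ C) → Integrable b ν := by
    rintro ν _ b hbm ⟨C, hC⟩
    exact Integrable.of_bound hbm.aestronglyMeasurable C (Eventually.of_forall hC)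
  have hsub : ∀ b c : UnitAddCircle → ℂ, Measurable b → Measurable c → (∃ C, ∀ z, ‖b z‖ ≤ C) →
      (∃ C, ∀ z, ‖c z‖ ≤ C) → Λ b = Λ c + Λ (fun z => b z - c z) := by
    intro b c hbm hcm hb hc
    simp only [hΛ, mul_sub]
    rw [integral_sub (hint b hbm hb) (hint c hcm hc),
      integral_sub (hint' κ b hbm hb) (hint' κ c hcm hc)]
    ring
  have hbound : ∀ b : UnitAddCircle → ℂ, Measurable b → (∃ C, ∀ z, ‖b z‖ ≤ C) →
      ‖Λ b‖ ≤ (1 + Q) * ∫ z, ‖b z‖ ∂(ρ + κ) := by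
    intro b hbm hb
    have e1 : ‖∫ x, q x * b (S x) ∂μ‖ ≤ ∫ z, ‖b z‖ ∂ρ := by
      refine (norm_integral_le_integral_norm _).trans (le_of_eq ?_)
      rw [hρ, integral_map hSm.aemeasurable hbm.norm.aestronglyMeasurable,
        integral_withDensity_eq_integral_toReal_smul₀ hq.1.enorm
          (Eventually.of_forall fun x => enorm_lt_top)]
      simp
    have e2 : ‖(∫ z, b z ∂κ) * ∫ x, q x ∂μ‖ ≤ (∫ z, ‖b z‖ ∂κ) * Q := by
      rw [norm_mul]
      exact mul_le_mul (norm_integral_le_integral_norm _) (norm_integral_le_integral_norm _)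
        (norm_nonneg _) (integral_nonneg fun _ => norm_nonneg _)
    have e3 : ∫ z, ‖b z‖ ∂(ρ + κ) = ∫ z, ‖b z‖ ∂ρ + ∫ z, ‖b z‖ ∂κ :=
      integral_add_measure (hint' ρ b hbm hb).norm (hint' κ b hbm hb).norm
    have e4 : 0 ≤ ∫ z, ‖b z‖ ∂ρ := integral_nonneg fun _ => norm_nonneg _
    have e5 : 0 ≤ ∫ z, ‖b z‖ ∂κ := integral_nonneg fun _ => norm_nonneg _
    have e6 := norm_sub_le (∫ x, q x * b (S x) ∂μ) ((∫ z, b z ∂κ) * ∫ x, q x ∂μ)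
    rw [e3]
    calc ‖Λ b‖ ≤ _ := e6
      _ ≤ ∫ z, ‖b z‖ ∂ρ + (∫ z, ‖b z‖ ∂κ) * Q := add_le_add e1 e2
      _ ≤ _ := by nlinarith [mul_nonneg hQ0 e4]
  have hCb : ∀ g : C(UnitAddCircle, ℂ), ∃ C, ∀ z, ‖g z‖ ≤ C := fun g => ⟨‖g‖, g.norm_coe_le_norm⟩
  -- the defect vanishes on trigonometric polynomials
  have hspan : ∀ P ∈ Submodule.span ℂ (Set.range (fourier (T := 1))), Λ P = 0 := by
    intro P hP
    induction hP using Submodule.span_induction with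
    | mem P hP =>
      obtain ⟨k, rfl⟩ := hP
      have hk : ∀ x, (fourier k (S x) : ℂ) = (Real.fourierChar (k * T x) : Circle) := by
        intro x
        rw [hS, fourier_coe_apply, Real.fourierChar_apply]
        congr 1
        push_cast
        ring
      by_cases hk0 : k = 0
      · subst hk0
        simp [hΛ, hκ]
      · have h2 : ∫ z, fourier k z ∂κ = 0 := by
          have := fourierCoeff_fourier (T := 1) k
          have h3 := congrFun this 0
          rw [Pi.single_eq_of_ne (Ne.symm hk0)] at h3
          simpa [fourierCoeff] using h3
        simp only [hΛ, hk, h k hk0, h2]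
        simp
    | zero => simp [hΛ]
    | add P R _ _ h1 h2 =>
      have := hsub (P + R : C(UnitAddCircle, ℂ)) P (P + R).continuous.measurable
        P.continuous.measurable (hCb _) (hCb _)
      simpa [h1, h2] using this
    | smul a P _ h1 =>
      have : Λ (a • P : C(UnitAddCircle, ℂ)) = a * Λ P := by
        simp only [hΛ, ContinuousMap.smul_apply, smul_eq_mul]
        have e1 : ∫ x, q x * (a * P (S x)) ∂μ = a * ∫ x, q x * P (S x) ∂μ := by
          rw [← integral_const_mul]
          congr 1
          funext x
          ring
        have e2 : ∫ z, a * P z ∂κ = a * ∫ z, P z ∂κ := integral_const_mul a _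
        rw [e1, e2]
        ring
      rw [this, h1, mul_zero]
  set Ψ : UnitAddCircle → ℂ := fun z => (circleFun ψ z : ℂ) with hΨ
  have hΨm : Measurable Ψ := Complex.measurable_ofReal.comp (measurable_circleFun hψ)
  have hΨb : ∃ C, ∀ z, ‖Ψ z‖ ≤ C := ⟨1, fun z => by simpa [hΨ, circleFun] using hb _⟩
  have hΨΛ : Λ Ψ = 0 := by
    rw [← norm_le_zero_iff]
    refine le_of_forall_pos_le_add fun δ hδ => ?_
    set N : ℝ := (ρ + κ).real Set.univ with hN
    have hN0 : 0 ≤ N := measureReal_nonneg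
    set η : ℝ := δ / ((1 + Q) * (1 + N)) with hη
    have hη0 : 0 < η := by positivity
    -- approximate in `L¹` by a continuous function, which is uniformly close to a trigonometric
    -- polynomial
    obtain ⟨g, hg, -⟩ := (hint' (ρ + κ) Ψ hΨm hΨb).exists_boundedContinuous_integral_sub_le hη0
    have hgcl : (⟨g, g.continuous⟩ : C(UnitAddCircle, ℂ)) ∈
        (Submodule.span ℂ (Set.range (fourier (T := 1)))).topologicalClosure := by
      rw [span_fourier_closure_eq_top]; trivial
    obtain ⟨P, hP, hPg⟩ := Metric.mem_closure_iff.1 hgcl η hη0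
    have hPz : ∀ z, ‖g z - P z‖ ≤ η := by
      intro z
      have := ContinuousMap.dist_apply_le_dist (f := ⟨g, g.continuous⟩) (g := P) z
      rw [dist_eq_norm] at this
      exact this.trans hPg.le
    have hdiff : ∫ z, ‖Ψ z - P z‖ ∂(ρ + κ) ≤ η * (1 + N) := by
      have hgb : ∃ C, ∀ z, ‖g z‖ ≤ C := ⟨‖g‖, g.norm_coe_le_norm⟩
      have i1 : Integrable (fun z => ‖Ψ z - g z‖) (ρ + κ) :=
        ((hint' (ρ + κ) Ψ hΨm hΨb).sub (hint' (ρ + κ) g g.continuous.measurable hgb)).norm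
      calc ∫ z, ‖Ψ z - P z‖ ∂(ρ + κ) ≤ ∫ z, (‖Ψ z - g z‖ + η) ∂(ρ + κ) := by
            refine integral_mono_of_nonneg (Eventually.of_forall fun _ => norm_nonneg _)
              (i1.add (integrable_const η)) (Eventually.of_forall fun z => ?_)
            have := norm_sub_le_norm_sub_add_norm_sub (Ψ z) (g z) (P z)
            exact this.trans (add_le_add le_rfl (hPz z))
        _ = ∫ z, ‖Ψ z - g z‖ ∂(ρ + κ) + N * η := by
            rw [integral_add i1 (integrable_const η), integral_const]
            rfl
        _ ≤ η * (1 + N) := by linarith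
    rw [hsub Ψ P hΨm P.continuous.measurable hΨb (hCb P), hspan P hP, zero_add, zero_add]
    refine (hbound _ (hΨm.sub P.continuous.measurable) ?_).trans ?_
    · obtain ⟨C, hC⟩ := hΨb
      obtain ⟨D, hD⟩ := hCb P
      exact ⟨C + D, fun z => (norm_sub_le _ _).trans (add_le_add (hC z) (hD z))⟩
    · calc (1 + Q) * ∫ z, ‖Ψ z - P z‖ ∂(ρ + κ) ≤ (1 + Q) * (η * (1 + N)) := by gcongr
        _ = δ := by rw [hη]; field_simp
  have hΨS : ∀ x, Ψ (S x) = (ψ (T x) : ℂ) := fun x => by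
    simp only [hΨ, hS, circleFun_coe hper]
  have hmean : ∫ z, Ψ z ∂κ = (periodMean ψ : ℂ) := integral_ofReal
  have hfinal : ∫ x, q x * ((ψ (T x) - periodMean ψ : ℝ) : ℂ) ∂μ = Λ Ψ := by
    simp only [Complex.ofReal_sub, mul_sub]
    rw [integral_sub, integral_mul_const, ← hmean]
    · simp only [hΛ, hΨS]
      ring
    · simpa only [hΨS] using hint Ψ hΨm hΨb
    · exact hq.mul_const _
  rw [hfinal, hΨΛ]

/-! ### Correlation of a periodic ridge function with a Fourier-concentrated density -/

theorem Lp_enorm_sq_eq_lintegral {X : Type*} [MeasurableSpace X] {μ : Measure X} (u : Lp ℂ 2 μ) :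
    ‖u‖ₑ ^ 2 = ∫⁻ x, ‖u x‖ₑ ^ 2 ∂μ := by
  have := eLpNorm_nnreal_pow_eq_lintegral (μ := μ) (f := u) (p := 2) (by norm_num)
  rw [Lp.enorm_def]
  simpa using this

/-- Restriction of an `L²` function to a measurable set. -/
theorem exists_restrict_Lp {X : Type*} [MeasurableSpace X] {μ : Measure X} {A : Set X}
    (hA : MeasurableSet A) (u : Lp ℂ 2 μ) :
    ∃ v : Lp ℂ 2 μ, (v =ᵐ[μ] A.indicator u) ∧ ‖v‖ ≤ ‖u‖ ∧
      ‖v‖ₑ ^ 2 = ∫⁻ x in A, ‖u x‖ₑ ^ 2 ∂μ := by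
  have hm : MemLp (A.indicator u) 2 μ := (Lp.memLp u).indicator hA
  refine ⟨hm.toLp _, hm.coeFn_toLp, ?_, ?_⟩
  · refine Lp.norm_le_norm_of_ae_le ?_
    filter_upwards [hm.coeFn_toLp] with x hx
    rw [hx]
    exact norm_indicator_le_norm_self _ _
  · rw [Lp_enorm_sq_eq_lintegral, ← lintegral_indicator hA]
    refine lintegral_congr_ae ?_
    filter_upwards [hm.coeFn_toLp] with x hx
    rw [hx]
    by_cases h : x ∈ A <;> simp [h]

section Correlation

variable {E : Type*} [NormedAddCommGroup E] [InnerProductSpace ℝ E]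

/-- The union of the balls of radius `r` around the nonzero integer multiples of `w`: the frequency
support of a mean-zero periodic function of `⟪w, x⟫` times a function with frequency support in the
ball of radius `r`. -/
def frequencyTube (r : ℝ) (w : E) : Set E := {y | ∃ k : ℤ, k ≠ 0 ∧ ‖y - (k : ℝ) • w‖ < r}

theorem isOpen_frequencyTube_prod (r : ℝ) : IsOpen {p : E × E | p.2 ∈ frequencyTube r p.1} := by
  have : {p : E × E | p.2 ∈ frequencyTube r p.1} =
      ⋃ k : ℤ, ⋃ _ : k ≠ 0, {p : E × E | ‖p.2 - (k : ℝ) • p.1‖ < r} := by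
    ext p
    simp [frequencyTube]
  rw [this]
  refine isOpen_iUnion fun k => isOpen_iUnion fun _ => isOpen_lt (by fun_prop) continuous_const

theorem isOpen_frequencyTube (r : ℝ) (w : E) : IsOpen (frequencyTube r w) :=
  (isOpen_frequencyTube_prod r).preimage (Continuous.prodMk_right w)

variable [FiniteDimensional ℝ E] [MeasurableSpace E] [BorelSpace E]

/-- A function with frequencies in the ball of radius `r`, multiplied by a mean-zero periodic
function of `⟪w, x⟫`, has its frequencies in the tube of `w`. -/
theorem integral_conj_mul_mul_comp_inner_eq_zero (V Φ : Lp ℂ 2 (volume : Measure E)) (w : E)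
    (r : ℝ) (hΦ : ∀ᵐ y, r ≤ ‖y‖ → (𝓕 Φ : Lp ℂ 2 (volume : Measure E)) y = 0)
    (hV : ∀ᵐ y, y ∈ frequencyTube r w → (𝓕 V : Lp ℂ 2 (volume : Measure E)) y = 0)
    {ψ : ℝ → ℝ} (hψ : Measurable ψ) (hb : ∀ t, |ψ t| ≤ 1) (hper : Function.Periodic ψ 1) :
    ∫ x, (starRingEnd ℂ (V x)) * Φ x * ((ψ (inner ℝ w x) - periodMean ψ : ℝ) : ℂ) = 0 := by
  refine integral_comp_periodic_sub_mean_eq_zero (T := fun x => inner ℝ w x) ?_ (by fun_prop) hψ hb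
    hper fun k hk => ?_
  · have := L2.integrable_inner (𝕜 := ℂ) V Φ
    simpa [RCLike.inner_apply, mul_comm] using this
  · have := integral_conj_mul_char_mul_eq_zero V Φ ((k : ℝ) • w) r hΦ ?_
    · simpa [inner_smul_left] using this
    · filter_upwards [hV] with y hy h
      exact hy ⟨k, hk, h⟩

/-- The correlation of `H` and `Φ` through a mean-zero periodic function of `⟪w, x⟫`: the part of
`Φ` with frequencies at least `r` is controlled trivially, while the rest is only correlated with
the part of `H` with frequencies in the tube around the multiples of `w`. -/
theorem enorm_integral_conj_mul_mul_comp_inner_sq_le (H Φ : Lp ℂ 2 (volume : Measure E)) (w : E)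
    (r : ℝ) {ψ : ℝ → ℝ} (hψ : Measurable ψ) (hb : ∀ t, |ψ t| ≤ 1) (hper : Function.Periodic ψ 1) :
    ‖∫ x, (starRingEnd ℂ (H x)) * Φ x * ((ψ (inner ℝ w x) - periodMean ψ : ℝ) : ℂ)‖ₑ ^ 2 ≤
      8 * (‖H‖ₑ ^ 2 * (∫⁻ y in {y | r ≤ ‖y‖}, ‖(𝓕 Φ : Lp ℂ 2 (volume : Measure E)) y‖ₑ ^ 2) +
        ‖Φ‖ₑ ^ 2 * ∫⁻ y in frequencyTube r w, ‖(𝓕 H : Lp ℂ 2 (volume : Measure E)) y‖ₑ ^ 2) := by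
  have hA : MeasurableSet {y : E | r ≤ ‖y‖} := measurableSet_le measurable_const measurable_norm
  have hS : MeasurableSet (frequencyTube r w) := (isOpen_frequencyTube r w).measurableSet
  obtain ⟨Pt, hPt, -, hPt2⟩ := exists_restrict_Lp hA (𝓕 Φ)
  obtain ⟨Pl, hPl, hPl1, -⟩ := exists_restrict_Lp hA.compl (𝓕 Φ)
  obtain ⟨Hs, hHs, -, hHs2⟩ := exists_restrict_Lp hS (𝓕 H)
  obtain ⟨Hc, hHc, -, -⟩ := exists_restrict_Lp hS.compl (𝓕 H)
  obtain ⟨M, hM, hM2⟩ := exists_mulCLM (μ := (volume : Measure E))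
    (b := fun x => ((ψ (inner ℝ w x) - periodMean ψ : ℝ) : ℂ)) (C := 2)
    (by
      refine Measurable.aestronglyMeasurable ?_
      have : Measurable fun x : E => ψ (inner ℝ w x) := hψ.comp (by fun_prop)
      fun_prop)
    (fun x => by
      rw [Complex.norm_real, Real.norm_eq_abs]
      exact (abs_sub _ _).trans (by linarith [hb (inner ℝ w x), abs_periodMean_le hb]))
  have hinner : ∀ U Ψ : Lp ℂ 2 (volume : Measure E), inner ℂ U (M Ψ) =
      ∫ x, (starRingEnd ℂ (U x)) * Ψ x * ((ψ (inner ℝ w x) - periodMean ψ : ℝ) : ℂ) := by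
    intro U Ψ
    rw [L2.inner_def]
    refine integral_congr_ae ?_
    filter_upwards [hM Ψ] with x hx
    rw [RCLike.inner_apply, hx]
    ring
  have hsum : ∀ {A : Set E} {a b u : Lp ℂ 2 (volume : Measure E)},
      a =ᵐ[volume] A.indicator u → b =ᵐ[volume] Aᶜ.indicator u → u = a + b := by
    intro A a b u ha hb
    apply Lp.ext
    filter_upwards [ha, hb, Lp.coeFn_add a b] with x h1 h2 h3
    rw [h3, Pi.add_apply, h1, h2]
    by_cases h : x ∈ A <;> simp [h]
  have hΦsum : Φ = 𝓕⁻ Pt + 𝓕⁻ Pl := by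
    rw [← FourierTransform.fourierInv_add, ← hsum hPt hPl, FourierTransform.fourierInv_fourier_eq]
  have hHsum : H = 𝓕⁻ Hs + 𝓕⁻ Hc := by
    rw [← FourierTransform.fourierInv_add, ← hsum hHs hHc, FourierTransform.fourierInv_fourier_eq]
  have hnorm : ∀ u : Lp ℂ 2 (volume : Measure E), ‖(𝓕⁻ u : Lp ℂ 2 (volume : Measure E))‖ = ‖u‖ :=
    fun u => (Lp.fourierTransformₗᵢ E ℂ).symm.norm_map u
  have hzero : inner ℂ (𝓕⁻ Hc : Lp ℂ 2 (volume : Measure E)) (M (𝓕⁻ Pl)) = 0 := by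
    rw [hinner]
    refine integral_conj_mul_mul_comp_inner_eq_zero _ _ w r ?_ ?_ hψ hb hper
    · rw [FourierTransform.fourier_fourierInv_eq]
      filter_upwards [hPl] with y hy h
      rw [hy, Set.indicator_of_notMem (by simpa using h)]
    · rw [FourierTransform.fourier_fourierInv_eq]
      filter_upwards [hHc] with y hy h
      rw [hy, Set.indicator_of_notMem (by simpa using h)]
  have hsplit : inner ℂ H (M Φ) = inner ℂ H (M (𝓕⁻ Pt)) +
      inner ℂ (𝓕⁻ Hs : Lp ℂ 2 (volume : Measure E)) (M (𝓕⁻ Pl)) := by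
    conv_lhs => rw [hΦsum, map_add, inner_add_right]
    congr 1
    conv_lhs => rw [hHsum, inner_add_left, hzero, add_zero]
  have hreal : ‖inner ℂ H (M Φ)‖ ^ 2 ≤ 8 * (‖H‖ ^ 2 * ‖Pt‖ ^ 2 + ‖Φ‖ ^ 2 * ‖Hs‖ ^ 2) := by
    have h1 : ‖inner ℂ H (M (𝓕⁻ Pt))‖ ≤ ‖H‖ * (2 * ‖Pt‖) := by
      refine (norm_inner_le_norm _ _).trans ?_
      gcongr
      exact (hM2 _).trans (by rw [hnorm])
    have h2 : ‖inner ℂ (𝓕⁻ Hs : Lp ℂ 2 (volume : Measure E)) (M (𝓕⁻ Pl))‖ ≤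
        ‖Hs‖ * (2 * ‖Φ‖) := by
      refine (norm_inner_le_norm _ _).trans ?_
      rw [hnorm]
      gcongr
      refine (hM2 _).trans ?_
      rw [hnorm]
      refine mul_le_mul_of_nonneg_left (hPl1.trans (Lp.norm_fourier_eq Φ).le) (by norm_num)
    have h3 : ‖inner ℂ H (M Φ)‖ ≤ ‖H‖ * (2 * ‖Pt‖) + ‖Hs‖ * (2 * ‖Φ‖) := by
      rw [hsplit]
      exact (norm_add_le _ _).trans (add_le_add h1 h2)
    calc ‖inner ℂ H (M Φ)‖ ^ 2 ≤ (‖H‖ * (2 * ‖Pt‖) + ‖Hs‖ * (2 * ‖Φ‖)) ^ 2 := by gcongr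
      _ ≤ _ := by nlinarith [sq_nonneg (‖H‖ * ‖Pt‖ - ‖Hs‖ * ‖Φ‖)]
  rw [← hinner, ← hPt2, ← hHs2]
  simp only [← ofReal_norm]
  rw [← ENNReal.ofReal_pow (norm_nonneg _), ← ENNReal.ofReal_pow (norm_nonneg _),
    ← ENNReal.ofReal_pow (norm_nonneg _), ← ENNReal.ofReal_pow (norm_nonneg _),
    ← ENNReal.ofReal_pow (norm_nonneg _), ← ENNReal.ofReal_mul (by positivity),
    ← ENNReal.ofReal_mul (by positivity), ← ENNReal.ofReal_add (by positivity) (by positivity),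
    show (8 : ℝ≥0∞) = ENNReal.ofReal 8 by simp, ← ENNReal.ofReal_mul (by norm_num)]
  exact ENNReal.ofReal_le_ofReal hreal

end Correlation

theorem lintegral_sqDensityMeasure {d : ℕ} {φ : EuclideanSpace ℝ (Fin d) → ℝ}
    (hφ : AEMeasurable φ) (F : EuclideanSpace ℝ (Fin d) → ℝ≥0∞) :
    ∫⁻ x, F x ∂(sqDensityMeasure φ) = ∫⁻ x, ENNReal.ofReal (φ x ^ 2) * F x := by
  rw [sqDensityMeasure, lintegral_withDensity_eq_lintegral_mul_non_measurable₀ _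
    (hφ.pow_const 2).ennreal_ofReal (Eventually.of_forall fun _ => ENNReal.ofReal_lt_top)]
  rfl

theorem FourierConcentrated.aemeasurable {d : ℕ} {ε : ℝ → ℝ} {φ : EuclideanSpace ℝ (Fin d) → ℝ}
    (h : FourierConcentrated ε φ) : AEMeasurable φ := by
  have := h.1.1.aemeasurable
  exact Complex.measurable_re.comp_aemeasurable this

/-- Fourier concentration bounds the correlation of `g` with a mean-zero periodic function of
`⟪w, x⟫` by the Fourier tail of the density and by the mass that a fixed function `K`, of the same
size as `g`, gives to the frequency tube of `w`. -/
theorem FourierConcentrated.exists_correlation_bound {d : ℕ} {ε : ℝ → ℝ}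
    {φ : EuclideanSpace ℝ (Fin d) → ℝ} (hφ : FourierConcentrated ε φ)
    (hφ1 : IsProbDensity fun x => φ x ^ 2) {g : EuclideanSpace ℝ (Fin d) → ℝ} (hg : Measurable g)
    (hg2 : ∫⁻ x, ‖g x‖ₑ ^ 2 ∂(sqDensityMeasure φ) ≠ ∞) {r : ℝ} (hr : 0 ≤ r) {ψ : ℝ → ℝ}
    (hψ : Measurable ψ) (hb : ∀ t, |ψ t| ≤ 1) (hper : Function.Periodic ψ 1) :
    ∃ K : EuclideanSpace ℝ (Fin d) → ℝ≥0∞, AEMeasurable K ∧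
      ∫⁻ y, K y = ∫⁻ x, ‖g x‖ₑ ^ 2 ∂(sqDensityMeasure φ) ∧
      ∀ w, ‖∫ x, (ψ (inner ℝ w x) - periodMean ψ) * g x ∂(sqDensityMeasure φ)‖ₑ ^ 2 ≤
        8 * ((∫⁻ x, ‖g x‖ₑ ^ 2 ∂(sqDensityMeasure φ)) * ENNReal.ofReal (ε r) ^ 2 +
          ∫⁻ y in frequencyTube r w, K y) := by
  have hφm : AEMeasurable φ := hφ.aemeasurable
  obtain ⟨h, hconc⟩ := hφ
  set Φ := h.toLp (fun x => (φ x : ℂ)) with hΦ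
  have hΦae : Φ =ᵐ[volume] fun x => (φ x : ℂ) := h.coeFn_toLp
  have hsq : ∀ x, ‖(g x * φ x : ℂ)‖ₑ ^ 2 = ENNReal.ofReal (φ x ^ 2) * ‖g x‖ₑ ^ 2 := by
    intro x
    rw [enorm_mul, mul_pow, mul_comm, ← ofReal_norm, ← ofReal_norm,
      ← ofReal_norm, Complex.norm_real, Complex.norm_real,
      ← ENNReal.ofReal_pow (norm_nonneg _), Real.norm_eq_abs (φ x), sq_abs]
  have hGeq : ∫⁻ x, ‖(g x * φ x : ℂ)‖ₑ ^ 2 = ∫⁻ x, ‖g x‖ₑ ^ 2 ∂(sqDensityMeasure φ) := by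
    rw [lintegral_sqDensityMeasure hφm]
    exact lintegral_congr hsq
  have hHm : MemLp (fun x => (g x * φ x : ℂ)) 2 (volume : Measure (EuclideanSpace ℝ (Fin d))) := by
    refine ⟨((Complex.measurable_ofReal.comp hg).aemeasurable.mul
      (Complex.measurable_ofReal.comp_aemeasurable hφm)).aestronglyMeasurable, ?_⟩
    have := eLpNorm_nnreal_pow_eq_lintegral (μ := (volume : Measure (EuclideanSpace ℝ (Fin d))))
      (f := fun x => (g x * φ x : ℂ)) (p := 2) (by norm_num)
    have h2 : eLpNorm (fun x => (g x * φ x : ℂ)) 2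
        (volume : Measure (EuclideanSpace ℝ (Fin d))) ^ 2 ≠ ∞ := by
      have h3 : eLpNorm (fun x => (g x * φ x : ℂ)) 2
        (volume : Measure (EuclideanSpace ℝ (Fin d))) ^ 2 = ∫⁻ x, ‖(g x * φ x : ℂ)‖ₑ ^ 2 := by
        simpa using this
      rw [h3, hGeq]
      exact hg2
    rw [lt_top_iff_ne_top]
    intro htop
    simp [htop] at h2
  set H := hHm.toLp _ with hH
  have hHae : H =ᵐ[volume] fun x => (g x * φ x : ℂ) := hHm.coeFn_toLp
  have hHnorm : ‖H‖ₑ ^ 2 = ∫⁻ x, ‖g x‖ₑ ^ 2 ∂(sqDensityMeasure φ) := by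
    rw [Lp_enorm_sq_eq_lintegral, ← hGeq]
    refine lintegral_congr_ae ?_
    filter_upwards [hHae] with x hx
    rw [hx]
  have hΦnorm : ‖Φ‖ₑ ^ 2 = 1 := by
    rw [Lp_enorm_sq_eq_lintegral]
    have : ∫⁻ x, ‖Φ x‖ₑ ^ 2 = ∫⁻ x, ENNReal.ofReal (φ x ^ 2) := by
      refine lintegral_congr_ae ?_
      filter_upwards [hΦae] with x hx
      rw [hx, ← ofReal_norm, Complex.norm_real, ← ENNReal.ofReal_pow (norm_nonneg _),
        Real.norm_eq_abs (φ x), sq_abs]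
    rw [this, ← ofReal_integral_eq_lintegral_ofReal hφ1.2.1 (Eventually.of_forall hφ1.1), hφ1.2.2,
      ENNReal.ofReal_one]
  have henormF : ∀ u : Lp ℂ 2 (volume : Measure (EuclideanSpace ℝ (Fin d))),
      ‖(𝓕 u : Lp ℂ 2 (volume : Measure (EuclideanSpace ℝ (Fin d))))‖ₑ = ‖u‖ₑ := by
    intro u
    rw [← ofReal_norm, Lp.norm_fourier_eq, ofReal_norm]
  have htail : ∫⁻ y in {y | r ≤ ‖y‖},
      ‖(𝓕 Φ : Lp ℂ 2 (volume : Measure (EuclideanSpace ℝ (Fin d)))) y‖ₑ ^ 2 ≤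
      ENNReal.ofReal (ε r) ^ 2 := by
    have hA : MeasurableSet {y : EuclideanSpace ℝ (Fin d) | r ≤ ‖y‖} :=
      measurableSet_le measurable_const measurable_norm
    have h1 := hconc r hr
    rw [← Lp.enorm_def, henormF] at h1
    have h2 := pow_le_pow_left₀ zero_le h1 2
    rw [mul_pow, hΦnorm, one_mul] at h2
    refine le_trans (le_of_eq ?_) h2
    have h3 := eLpNorm_nnreal_pow_eq_lintegral
      (μ := (volume : Measure (EuclideanSpace ℝ (Fin d))))
      (f := Set.indicator {x : EuclideanSpace ℝ (Fin d) | r ≤ ‖x‖}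
          (𝓕 Φ : Lp ℂ 2 (volume : Measure (EuclideanSpace ℝ (Fin d))))) (p := 2) (by norm_num)
    rw [← lintegral_indicator hA]
    refine Eq.trans (lintegral_congr fun y => ?_) (Eq.trans (Eq.symm h3) (by norm_num))
    by_cases hy : r ≤ ‖y‖ <;> simp [hy]
  refine ⟨fun y => ‖(𝓕 H : Lp ℂ 2 (volume : Measure (EuclideanSpace ℝ (Fin d)))) y‖ₑ ^ 2,
    (Lp.aestronglyMeasurable _).enorm.pow_const 2, ?_, fun w => ?_⟩
  · rw [← Lp_enorm_sq_eq_lintegral, henormF, hHnorm]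
  · have hint : ((∫ x, (ψ (inner ℝ w x) - periodMean ψ) * g x ∂(sqDensityMeasure φ) : ℝ) : ℂ) =
        ∫ x, (starRingEnd ℂ (H x)) * Φ x * ((ψ (inner ℝ w x) - periodMean ψ : ℝ) : ℂ) := by
      rw [sqDensityMeasure, integral_withDensity_eq_integral_toReal_smul₀
        (hφm.pow_const 2).ennreal_ofReal (Eventually.of_forall fun _ => ENNReal.ofReal_lt_top),
        ← integral_complex_ofReal]
      refine integral_congr_ae ?_
      filter_upwards [hΦae, hHae] with x h1 h2
      rw [h1, h2, ENNReal.toReal_ofReal (sq_nonneg _)]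
      simp only [smul_eq_mul, map_mul, Complex.conj_ofReal]
      push_cast
      ring
    have henorm : ‖∫ x, (ψ (inner ℝ w x) - periodMean ψ) * g x ∂(sqDensityMeasure φ)‖ₑ =
        ‖∫ x, (starRingEnd ℂ (H x)) * Φ x * ((ψ (inner ℝ w x) - periodMean ψ : ℝ) : ℂ)‖ₑ := by
      rw [← hint, ← ofReal_norm, ← ofReal_norm, Complex.norm_real]
    rw [henorm]
    refine (enorm_integral_conj_mul_mul_comp_inner_sq_le H Φ w r hψ hb hper).trans ?_
    rw [hHnorm, hΦnorm, one_mul]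
    gcongr

/-! ### Frequency tubes of a random direction -/

/-- The cone over a spherical cap of angle less than a right angle lies in a ball of radius less
than `1`, so that the cap has exponentially small measure. -/
theorem toSphere_cap_le {E : Type*} [NormedAddCommGroup E] [InnerProductSpace ℝ E]
    [FiniteDimensional ℝ E] [MeasurableSpace E] [BorelSpace E] {e : E} (he : ‖e‖ = 1) :
    (volume : Measure E).toSphere {u : Metric.sphere (0 : E) 1 | 3 / 4 ≤ inner ℝ (u : E) e} ≤
      ENNReal.ofReal (√(1 / 2) ^ Module.finrank ℝ E) *
        (volume : Measure E).toSphere Set.univ := by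
  have hm : MeasurableSet {u : Metric.sphere (0 : E) 1 | 3 / 4 ≤ inner ℝ (u : E) e} :=
    (isClosed_le continuous_const (by fun_prop)).measurableSet
  rw [Measure.toSphere_apply' _ hm, Measure.toSphere_apply_univ, mul_left_comm]
  gcongr
  -- for `s ∈ (0, 1)`, the squared distance of `s • u` to `e / 2` is at most
  -- `s ^ 2 - 3 / 4 * s + 1 / 4 ≤ 1 / 2`
  refine (measure_mono (t := Metric.closedBall ((1 / 2 : ℝ) • e) √(1 / 2)) ?_).trans_eq
    (Measure.addHaar_closedBall _ _ (Real.sqrt_nonneg _))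
  rintro x hx
  obtain ⟨s, ⟨hs0, hs1⟩, -, ⟨u, hu, rfl⟩, rfl⟩ := Set.mem_smul.1 hx
  have hu1 : ‖(u : E)‖ = 1 := by simp
  rw [mem_closedBall_iff_norm]
  refine Real.le_sqrt_of_sq_le ?_
  simp only [Set.mem_ofPred_eq] at hu
  rw [@norm_sub_sq ℝ, norm_smul, norm_smul, hu1, he, inner_smul_left, inner_smul_right]
  simp only [Real.norm_eq_abs, mul_one, sq_abs, conj_trivial, RCLike.re_to_real]
  nlinarith [mul_nonneg hs0.le (sub_nonneg.2 hu), mul_pos hs0 (sub_pos.2 hs1)]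

/-- Points of the tube of a vector of norm `2r` are at distance less than `r` from a multiple of
norm at least `2r`, so their angle with the line of this vector is less than `30°`; the bound `3 / 4`
is used in place of `√3 / 2`. -/
theorem norm_le_abs_inner_of_mem_frequencyTube {E : Type*} [NormedAddCommGroup E]
    [InnerProductSpace ℝ E] {r : ℝ} (hr : 0 ≤ r) {u y : E} (hu : ‖u‖ = 1)
    (hy : y ∈ frequencyTube r ((2 * r) • u)) : 0 < ‖y‖ ∧ 3 / 4 * ‖y‖ ≤ |inner ℝ u y| := by
  obtain ⟨k, hk, h⟩ := hy
  have hr0 : 0 < r := (norm_nonneg _).trans_lt h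
  have hk1 : (1 : ℝ) ≤ |(k : ℝ)| := by exact_mod_cast Int.one_le_abs hk
  rw [smul_smul] at h
  set c : ℝ := (k : ℝ) * (2 * r) with hc
  have hcabs : 2 * r ≤ |c| := by
    rw [hc, abs_mul, abs_of_pos (show 0 < 2 * r by positivity)]
    nlinarith
  have h2 : ‖y - c • u‖ ^ 2 < r ^ 2 := by gcongr
  rw [@norm_sub_sq ℝ, norm_smul, hu, inner_smul_right, real_inner_comm] at h2
  simp only [Real.norm_eq_abs, mul_one, sq_abs, RCLike.re_to_real] at h2
  have h3 : c * inner ℝ u y ≤ |c| * |inner ℝ u y| := by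
    rw [← abs_mul]; exact le_abs_self _
  have h4 := sq_abs c
  have hI := abs_real_inner_le_norm u y
  rw [hu, one_mul] at hI
  have hy0 := norm_nonneg y
  have hcp : 0 < |c| := by linarith
  have hr2 : r ^ 2 ≤ c ^ 2 / 4 := by nlinarith
  constructor
  · by_contra hcon
    have h5 : ‖y‖ = 0 := le_antisymm (not_lt.1 hcon) hy0
    have h6 : |inner ℝ u y| = 0 := le_antisymm (h5 ▸ hI) (abs_nonneg _)
    rw [h6, mul_zero] at h3
    nlinarith
  · by_contra hcon
    push Not at hcon
    nlinarith [sq_nonneg (‖y‖ - 3 / 4 * |c|), mul_lt_mul_of_pos_left hcon hcp]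

instance isProbabilityMeasure_uniformSphere (d : ℕ) [NeZero d] (ρ : ℝ) :
    IsProbabilityMeasure (uniformSphere d ρ) := by
  have : Nontrivial (EuclideanSpace ℝ (Fin d)) := by
    apply Module.nontrivial_of_finrank_pos (R := ℝ)
    simpa using NeZero.pos d
  have : NeZero (volume : Measure (EuclideanSpace ℝ (Fin d))).toSphere :=
    ⟨Measure.toSphere_ne_zero _⟩
  have h : IsProbabilityMeasure
      (((volume : Measure (EuclideanSpace ℝ (Fin d))).toSphere Set.univ)⁻¹ •
      (volume : Measure (EuclideanSpace ℝ (Fin d))).toSphere) :=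
    isProbabilityMeasureSMul
  exact Measure.isProbabilityMeasure_map (by fun_prop)

/-- A fixed frequency lies in the frequency tube of a random vector of norm `2r` with exponentially
small probability. -/
theorem uniformSphere_mem_frequencyTube_le (d : ℕ) [NeZero d] {r : ℝ} (hr : 0 ≤ r)
    (y : EuclideanSpace ℝ (Fin d)) :
    uniformSphere d (2 * r) {w | y ∈ frequencyTube r w} ≤ 2 * ENNReal.ofReal (√(1 / 2) ^ d) := by
  have : Nontrivial (EuclideanSpace ℝ (Fin d)) := by
    apply Module.nontrivial_of_finrank_pos (R := ℝ)
    simpa using NeZero.pos d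
  have hm : MeasurableSet {w : EuclideanSpace ℝ (Fin d) | y ∈ frequencyTube r w} :=
    ((isOpen_frequencyTube_prod r).preimage (Continuous.prodMk_left y)).measurableSet
  rw [uniformSphere, Measure.map_apply (by fun_prop) hm, Measure.smul_apply, smul_eq_mul]
  set τ := (volume : Measure (EuclideanSpace ℝ (Fin d))).toSphere with hτ
  have hτ0 : τ Set.univ ≠ 0 := Measure.measure_univ_ne_zero.2 (Measure.toSphere_ne_zero _)
  have hτt : τ Set.univ ≠ ∞ := measure_ne_top _ _
  suffices h : τ ((fun u : Metric.sphere (0 : EuclideanSpace ℝ (Fin d)) 1 =>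
      (2 * r) • (u : EuclideanSpace ℝ (Fin d))) ⁻¹' {w | y ∈ frequencyTube r w}) ≤
      2 * ENNReal.ofReal (√(1 / 2) ^ d) * τ Set.univ by
    calc _ ≤ (τ Set.univ)⁻¹ * (2 * ENNReal.ofReal (√(1 / 2) ^ d) * τ Set.univ) := by gcongr
      _ = 2 * ENNReal.ofReal (√(1 / 2) ^ d) * ((τ Set.univ)⁻¹ * τ Set.univ) := by ring
      _ = _ := by rw [ENNReal.inv_mul_cancel hτ0 hτt, mul_one]
  -- `y` in the tube forces the direction into one of the two caps centred at `± y / ‖y‖`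
  rcases eq_or_ne y 0 with rfl | hy
  · refine le_of_eq_of_le ?_ zero_le
    rw [← measure_empty (μ := τ)]
    congr 1
    ext u
    simp only [Set.mem_preimage, Set.mem_ofPred_eq, Set.mem_empty_iff_false, iff_false]
    intro hu
    have := (norm_le_abs_inner_of_mem_frequencyTube hr (by simp) hu).1
    simp at this
  have hyn : 0 < ‖y‖ := norm_pos_iff.2 hy
  set e : EuclideanSpace ℝ (Fin d) := ‖y‖⁻¹ • y with he
  have he1 : ‖e‖ = 1 := norm_smul_inv_norm hy
  have he2 : ‖-e‖ = 1 := by rw [norm_neg, he1]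
  have hcap := toSphere_cap_le he1
  have hcap' := toSphere_cap_le he2
  rw [finrank_euclideanSpace_fin, ← hτ] at hcap hcap'
  calc _ ≤ τ ({u | 3 / 4 ≤ inner ℝ (u : EuclideanSpace ℝ (Fin d)) e} ∪
        {u | 3 / 4 ≤ inner ℝ (u : EuclideanSpace ℝ (Fin d)) (-e)}) := by
        refine measure_mono fun u hu => ?_
        have h := (norm_le_abs_inner_of_mem_frequencyTube hr (by simp) hu).2
        have h2 : (inner ℝ (u : EuclideanSpace ℝ (Fin d)) e : ℝ) =
            inner ℝ (u : EuclideanSpace ℝ (Fin d)) y / ‖y‖ := by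
          rw [he, inner_smul_right]; ring
        have h3 : 3 / 4 ≤ |(inner ℝ (u : EuclideanSpace ℝ (Fin d)) e : ℝ)| := by
          rw [h2, abs_div, abs_norm, le_div_iff₀ hyn]
          exact h
        rcases le_abs.1 h3 with h4 | h4
        · exact Or.inl h4
        · exact Or.inr (by simpa [inner_neg_right] using h4)
    _ ≤ _ := (measure_union_le _ _).trans ((add_le_add hcap hcap').trans_eq (by ring))

/-- On average over directions, the frequency tubes receive an exponentially small fraction of the
mass of a fixed function. -/
theorem lintegral_uniformSphere_lintegral_frequencyTube_le (d : ℕ) [NeZero d] {r : ℝ} (hr : 0 ≤ r)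
    {K : EuclideanSpace ℝ (Fin d) → ℝ≥0∞} (hK : AEMeasurable K) :
    ∫⁻ w, (∫⁻ y in frequencyTube r w, K y) ∂(uniformSphere d (2 * r)) ≤
      2 * ENNReal.ofReal (√(1 / 2) ^ d) * ∫⁻ y, K y := by
  have hm := (isOpen_frequencyTube_prod (E := EuclideanSpace ℝ (Fin d)) r).measurableSet
  have h1 : ∀ w, ∫⁻ y in frequencyTube r w, K y =
      ∫⁻ y, {p : EuclideanSpace ℝ (Fin d) × EuclideanSpace ℝ (Fin d) |
        p.2 ∈ frequencyTube r p.1}.indicator (fun p => K p.2) (w, y) := by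
    intro w
    rw [← lintegral_indicator (isOpen_frequencyTube r w).measurableSet]
    rfl
  simp only [h1]
  rw [lintegral_lintegral_swap, ← lintegral_const_mul'' _ hK]
  · refine lintegral_mono fun y => ?_
    have hmy : MeasurableSet {w : EuclideanSpace ℝ (Fin d) | y ∈ frequencyTube r w} :=
      ((isOpen_frequencyTube_prod r).preimage (Continuous.prodMk_left y)).measurableSet
    change ∫⁻ w, {w | y ∈ frequencyTube r w}.indicator (fun _ => K y) w ∂_ ≤ _
    rw [lintegral_indicator_const hmy, mul_comm]
    gcongr
    exact uniformSphere_mem_frequencyTube_le d hr y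
  · exact (hK.comp_snd).indicator hm

/-! ### Mixtures -/

theorem sq_lintegral_le_lintegral_sq {X : Type*} [MeasurableSpace X] {ν : Measure X}
    [IsProbabilityMeasure ν] {F : X → ℝ≥0∞} (hF : AEMeasurable F ν) :
    (∫⁻ x, F x ∂ν) ^ 2 ≤ ∫⁻ x, F x ^ 2 ∂ν := by
  have h := ENNReal.lintegral_mul_le_Lp_mul_Lq ν (Real.HolderConjugate.two_two) hF
    (aemeasurable_const (b := (1 : ℝ≥0∞)))
  simp only [Pi.mul_apply, mul_one, lintegral_const, measure_univ,
    ENNReal.rpow_two, one_pow, ENNReal.one_rpow] at h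
  calc (∫⁻ x, F x ∂ν) ^ 2 ≤ ((∫⁻ x, F x ^ 2 ∂ν) ^ (1 / 2 : ℝ)) ^ 2 := by gcongr
    _ = ∫⁻ x, F x ^ 2 ∂ν := by
      rw [← ENNReal.rpow_natCast, ← ENNReal.rpow_mul]
      norm_num

/-- Jensen's inequality for the square and a countable convex combination. -/
theorem sq_tsum_mul_le_tsum_mul_sq {ι : Type*} {a : ι → ℝ≥0∞} (ha : ∑' i, a i = 1)
    (x : ι → ℝ≥0∞) : (∑' i, a i * x i) ^ 2 ≤ ∑' i, a i * x i ^ 2 := by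
  let _ : MeasurableSpace ι := ⊤
  set ν : Measure ι := Measure.sum fun i => a i • Measure.dirac i with hν
  have hint : ∀ F : ι → ℝ≥0∞, ∫⁻ i, F i ∂ν = ∑' i, a i * F i := by
    intro F
    simp [hν, lintegral_sum_measure, lintegral_smul_measure]
  have : IsProbabilityMeasure ν := ⟨by
    have := hint fun _ => 1
    simpa [ha] using this⟩
  rw [← hint, ← hint]
  exact sq_lintegral_le_lintegral_sq (Measurable.of_discrete).aemeasurable

theorem IsProbDensity.isProbabilityMeasure {d : ℕ} {φ : EuclideanSpace ℝ (Fin d) → ℝ}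
    (h : IsProbDensity fun x => φ x ^ 2) : IsProbabilityMeasure (sqDensityMeasure φ) := by
  refine ⟨?_⟩
  rw [sqDensityMeasure, withDensity_apply _ MeasurableSet.univ, Measure.restrict_univ,
    ← ofReal_integral_eq_lintegral_ofReal h.2.1 (Eventually.of_forall h.1), h.2.2,
    ENNReal.ofReal_one]

section Mixture

variable {d : ℕ} {ι : Type} {ε : ℝ → ℝ} {φ : EuclideanSpace ℝ (Fin d) → ℝ} {α : ι → ℝ}
  {φs : ι → EuclideanSpace ℝ (Fin d) → ℝ}

theorem IsFourierMixture.sqDensityMeasure_eq_sum (h : IsFourierMixture ε φ α φs) :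
    sqDensityMeasure φ =
      Measure.sum fun i => ENNReal.ofReal (α i) • sqDensityMeasure (φs i) := by
  have := h.countable
  ext s hs
  rw [Measure.sum_apply _ hs, sqDensityMeasure, withDensity_apply _ hs]
  have h1 : ∀ i, (ENNReal.ofReal (α i) • sqDensityMeasure (φs i)) s =
      ∫⁻ x in s, ENNReal.ofReal (α i) * ENNReal.ofReal (φs i x ^ 2) := by
    intro i
    rw [Measure.smul_apply, smul_eq_mul, sqDensityMeasure, withDensity_apply _ hs,
      lintegral_const_mul' _ _ ENNReal.ofReal_ne_top]
  simp only [h1]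
  rw [← lintegral_tsum fun i =>
    (((h.concentrated i).aemeasurable.pow_const 2).ennreal_ofReal.const_mul _).restrict]
  refine lintegral_congr_ae (ae_restrict_of_ae ?_)
  filter_upwards [h.mixture] with x hx
  simp only [← ENNReal.ofReal_mul (h.weight_nonneg _)]
  rw [← hx.tsum_eq, ENNReal.ofReal_tsum_of_nonneg (fun i => mul_nonneg (h.weight_nonneg i)
    (sq_nonneg _)) hx.summable]

theorem measurable_integral_comp_inner {μ : Measure (EuclideanSpace ℝ (Fin d))} [SFinite μ]
    {ψ : ℝ → ℝ} (hψ : Measurable ψ) {g : EuclideanSpace ℝ (Fin d) → ℝ} (hg : Measurable g) (c : ℝ) :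
    Measurable fun w => ∫ x, (ψ (inner ℝ w x) - c) * g x ∂μ := by
  refine (StronglyMeasurable.integral_prod_right (f := fun (w x : EuclideanSpace ℝ (Fin d)) =>
    (ψ (inner ℝ w x) - c) * g x) ?_).measurable
  refine Measurable.stronglyMeasurable ?_
  have : Measurable fun p : EuclideanSpace ℝ (Fin d) × EuclideanSpace ℝ (Fin d) =>
      ψ (inner ℝ p.1 p.2) := hψ.comp (by fun_prop)
  exact (this.sub_const c).mul (hg.comp measurable_snd)

/-- The second moment, over a random direction `w`, of the correlation of `g` with a mean-zero
periodic function of `⟪w, x⟫`. -/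
theorem FourierConcentrated.lintegral_correlation_sq_le [NeZero d]
    {φ : EuclideanSpace ℝ (Fin d) → ℝ}
    (hφ : FourierConcentrated ε φ) (hφ1 : IsProbDensity fun x => φ x ^ 2)
    {g : EuclideanSpace ℝ (Fin d) → ℝ} (hg : Measurable g)
    (hg2 : ∫⁻ x, ‖g x‖ₑ ^ 2 ∂(sqDensityMeasure φ) ≠ ∞) {r : ℝ} (hr : 0 ≤ r) {ψ : ℝ → ℝ}
    (hψ : Measurable ψ) (hb : ∀ t, |ψ t| ≤ 1) (hper : Function.Periodic ψ 1) :
    ∫⁻ w, ‖∫ x, (ψ (inner ℝ w x) - periodMean ψ) * g x ∂(sqDensityMeasure φ)‖ₑ ^ 2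
        ∂(uniformSphere d (2 * r)) ≤
      8 * (ENNReal.ofReal (ε r) ^ 2 + 2 * ENNReal.ofReal (√(1 / 2) ^ d)) *
        ∫⁻ x, ‖g x‖ₑ ^ 2 ∂(sqDensityMeasure φ) := by
  obtain ⟨K, hK, hKG, hbound⟩ := hφ.exists_correlation_bound hφ1 hg hg2 hr hψ hb hper
  set G := ∫⁻ x, ‖g x‖ₑ ^ 2 ∂(sqDensityMeasure φ) with hG
  calc _ ≤ ∫⁻ w, 8 * (G * ENNReal.ofReal (ε r) ^ 2 + ∫⁻ y in frequencyTube r w, K y)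
        ∂(uniformSphere d (2 * r)) := lintegral_mono hbound
    _ = 8 * (G * ENNReal.ofReal (ε r) ^ 2 +
        ∫⁻ w, (∫⁻ y in frequencyTube r w, K y) ∂(uniformSphere d (2 * r))) := by
      rw [lintegral_const_mul' _ _ (by norm_num), lintegral_add_left measurable_const,
        lintegral_const, measure_univ, mul_one]
    _ ≤ 8 * (G * ENNReal.ofReal (ε r) ^ 2 + 2 * ENNReal.ofReal (√(1 / 2) ^ d) * G) := by
      gcongr
      rw [← hKG]
      exact lintegral_uniformSphere_lintegral_frequencyTube_le d hr hK
    _ = _ := by ring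

/-- The second moment bound for one component passes to mixtures by Jensen's inequality, both sides
being averaged with the weights of the mixture. -/
theorem IsFourierMixture.lintegral_correlation_sq_le [NeZero d] (h : IsFourierMixture ε φ α φs)
    {g : EuclideanSpace ℝ (Fin d) → ℝ} (hg : Measurable g)
    (hg2 : ∫⁻ x, ‖g x‖ₑ ^ 2 ∂(sqDensityMeasure φ) ≠ ∞) {r : ℝ} (hr : 0 ≤ r) {ψ : ℝ → ℝ}
    (hψ : Measurable ψ) (hb : ∀ t, |ψ t| ≤ 1) (hper : Function.Periodic ψ 1) :
    ∫⁻ w, ‖∫ x, (ψ (inner ℝ w x) - periodMean ψ) * g x ∂(sqDensityMeasure φ)‖ₑ ^ 2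
        ∂(uniformSphere d (2 * r)) ≤
      8 * (ENNReal.ofReal (ε r) ^ 2 + 2 * ENNReal.ofReal (√(1 / 2) ^ d)) *
        ∫⁻ x, ‖g x‖ₑ ^ 2 ∂(sqDensityMeasure φ) := by
  have := h.countable
  have := h.density.isProbabilityMeasure
  have hsf : ∀ i, SFinite (sqDensityMeasure (φs i)) := fun i => by
    unfold sqDensityMeasure
    infer_instance
  set C := 8 * (ENNReal.ofReal (ε r) ^ 2 + 2 * ENNReal.ofReal (√(1 / 2) ^ d)) with hC
  set a : ι → ℝ≥0∞ := fun i => ENNReal.ofReal (α i) with ha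
  have ha1 : ∑' i, a i = 1 := by
    rw [ha, ← ENNReal.ofReal_tsum_of_nonneg h.weight_nonneg h.weight_sum.summable,
      h.weight_sum.tsum_eq, ENNReal.ofReal_one]
  set b : ι → EuclideanSpace ℝ (Fin d) → ℝ := fun i w =>
    ∫ x, (ψ (inner ℝ w x) - periodMean ψ) * g x ∂(sqDensityMeasure (φs i)) with hbdef
  have hGsum : ∫⁻ x, ‖g x‖ₑ ^ 2 ∂(sqDensityMeasure φ) =
      ∑' i, a i * ∫⁻ x, ‖g x‖ₑ ^ 2 ∂(sqDensityMeasure (φs i)) := by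
    rw [h.sqDensityMeasure_eq_sum, lintegral_sum_measure]
    simp only [lintegral_smul_measure, smul_eq_mul, ha]
  have hgint : Integrable g (sqDensityMeasure φ) := by
    refine ⟨hg.aestronglyMeasurable, ?_⟩
    have h1 := sq_lintegral_le_lintegral_sq (ν := sqDensityMeasure φ) hg.enorm.aemeasurable
    refine lt_top_iff_ne_top.2 fun htop => ?_
    rw [htop] at h1
    exact hg2 (top_le_iff.1 (by simpa using h1))
  have hint : ∀ w, Integrable (fun x => (ψ (inner ℝ w x) - periodMean ψ) * g x)
      (sqDensityMeasure φ) := by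
    intro w
    refine hgint.bdd_mul (c := 2) ?_ (Eventually.of_forall fun x => ?_)
    · exact ((hψ.comp (by fun_prop : Measurable fun x : EuclideanSpace ℝ (Fin d) =>
        (inner ℝ w x : ℝ))).sub_const _).aestronglyMeasurable
    · rw [Real.norm_eq_abs]
      exact (abs_sub _ _).trans (by linarith [hb (inner ℝ w x), abs_periodMean_le hb])
  have hpt : ∀ w, ‖∫ x, (ψ (inner ℝ w x) - periodMean ψ) * g x ∂(sqDensityMeasure φ)‖ₑ ^ 2 ≤
      ∑' i, a i * ‖b i w‖ₑ ^ 2 := by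
    intro w
    have hs := hint w
    rw [h.sqDensityMeasure_eq_sum] at hs ⊢
    have h1 := hasSum_integral_measure hs
    rw [← h1.tsum_eq]
    refine le_trans ?_ (sq_tsum_mul_le_tsum_mul_sq ha1 _)
    gcongr
    refine (enorm_tsum_le_tsum_enorm).trans (ENNReal.tsum_le_tsum fun i => ?_)
    rw [integral_smul_measure, enorm_smul, ENNReal.toReal_ofReal (h.weight_nonneg i),
      Real.enorm_of_nonneg (h.weight_nonneg i)]
  have hbm : ∀ i, Measurable (b i) := fun i => measurable_integral_comp_inner hψ hg _
  calc _ ≤ ∫⁻ w, ∑' i, a i * ‖b i w‖ₑ ^ 2 ∂(uniformSphere d (2 * r)) := lintegral_mono hpt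
    _ = ∑' i, a i * ∫⁻ w, ‖b i w‖ₑ ^ 2 ∂(uniformSphere d (2 * r)) := by
      rw [lintegral_tsum fun i => (((hbm i).enorm.pow_const 2).const_mul _).aemeasurable]
      simp only [lintegral_const_mul' _ _ ENNReal.ofReal_ne_top, ha]
    _ ≤ ∑' i, a i * (C * ∫⁻ x, ‖g x‖ₑ ^ 2 ∂(sqDensityMeasure (φs i))) := by
      refine ENNReal.tsum_le_tsum fun i => ?_
      rcases eq_or_ne (a i) 0 with h0 | h0
      · simp [h0]
      gcongr
      refine (h.concentrated i).lintegral_correlation_sq_le (h.density_component i) hg ?_ hr hψ hb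
        hper
      -- a component of positive weight inherits square integrability from the mixture
      intro htop
      refine hg2 (top_le_iff.1 ?_)
      rw [hGsum]
      refine le_trans ?_ (ENNReal.le_tsum i)
      rw [htop, ENNReal.mul_top h0]
    _ = C * ∫⁻ x, ‖g x‖ₑ ^ 2 ∂(sqDensityMeasure φ) := by
      rw [hGsum, ← ENNReal.tsum_mul_left]
      exact tsum_congr fun i => mul_left_comm _ _ _

end Mixture

/-! ### Differentiation of the squared loss -/

/-- A sequence bounded in `L²` and converging to `0` almost everywhere converges weakly to `0`. -/
theorem tendsto_integral_mul_of_bounded_of_tendsto_ae {X : Type*} [MeasurableSpace X]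
    {μ : Measure X} [IsFiniteMeasure μ] {R : ℕ → X → ℝ} {h : X → ℝ} (hh : MemLp h 2 μ)
    (hR : ∀ n, MemLp (R n) 2 μ) {C : ℝ} (hC : ∀ n, ∫ x, R n x ^ 2 ∂μ ≤ C)
    (hlim : ∀ᵐ x ∂μ, Tendsto (fun n => R n x) atTop (𝓝 0)) :
    Tendsto (fun n => ∫ x, R n x * h x ∂μ) atTop (𝓝 0) := by
  have hC0 : 0 ≤ C := (integral_nonneg fun x => sq_nonneg _).trans (hC 0)
  have hnorm : ∀ n, eLpNorm (R n) 2 μ ≤ ENNReal.ofReal √C := by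
    intro n
    have h1 := eLpNorm_nnreal_pow_eq_lintegral (μ := μ) (f := R n) (p := 2) (by norm_num)
    have h2 : eLpNorm (R n) 2 μ ^ 2 = ENNReal.ofReal (∫ x, R n x ^ 2 ∂μ) := by
      rw [ofReal_integral_eq_lintegral_ofReal (hR n).integrable_sq
        (Eventually.of_forall fun x => sq_nonneg _)]
      have h3 : ∀ x, ENNReal.ofReal (R n x ^ 2) = ‖R n x‖ₑ ^ 2 := fun x => by
        rw [← ofReal_norm, ← ENNReal.ofReal_pow (norm_nonneg _), Real.norm_eq_abs, sq_abs]
      simp only [h3]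
      simpa using h1
    have h4 : eLpNorm (R n) 2 μ ^ 2 ≤ ENNReal.ofReal √C ^ 2 := by
      rw [h2, ← ENNReal.ofReal_pow (Real.sqrt_nonneg _), Real.sq_sqrt hC0]
      exact ENNReal.ofReal_le_ofReal (hC n)
    exact (ENNReal.pow_le_pow_left_iff two_ne_zero).1 h4
  have hui : UnifIntegrable (fun n x => R n x * h x) 1 μ := by
    intro δ hδ
    obtain ⟨η, hη, hη2⟩ := hh.eLpNorm_indicator_le (by norm_num) (by norm_num)
      (ε := δ / (√C + 1)) (by positivity)
    refine ⟨η, hη, fun n s hs hμs => ?_⟩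
    have e1 : s.indicator (fun x => R n x * h x) = R n • s.indicator h := by
      ext x
      by_cases hx : x ∈ s <;> simp [hx]
    rw [e1]
    refine (eLpNorm_smul_le_mul_eLpNorm (p := 2) (q := 2) (hh.1.indicator hs) (hR n).1).trans ?_
    calc _ ≤ ENNReal.ofReal √C * ENNReal.ofReal (δ / (√C + 1)) :=
          mul_le_mul' (hnorm n) (hη2 s hs hμs)
      _ = ENNReal.ofReal (√C * (δ / (√C + 1))) := by rw [ENNReal.ofReal_mul (Real.sqrt_nonneg _)]
      _ ≤ ENNReal.ofReal δ := by
        refine ENNReal.ofReal_le_ofReal ?_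
        rw [mul_div_assoc', div_le_iff₀ (by positivity)]
        nlinarith [Real.sqrt_nonneg C]
  have hL1 := tendsto_Lp_finite_of_tendsto_ae (μ := μ) (p := 1) le_rfl ENNReal.one_ne_top
    (f := fun n x => R n x * h x) (g := fun _ => 0) (fun n => (hR n).1.mul hh.1)
    (MemLp.zero' ) hui (by
      filter_upwards [hlim] with x hx
      simpa using hx.mul_const (h x))
  have := tendsto_integral_of_L1' (fun _ : X => (0 : ℝ)) aestronglyMeasurable_const
    (Eventually.of_forall fun n => (hR n).integrable_mul hh) hL1
  simpa using this

theorem MeasureTheory.MemLp.integrable_smul_of_two {X H : Type*} [MeasurableSpace X]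
    {μ : Measure X} [NormedAddCommGroup H] [NormedSpace ℝ H] {a : X → ℝ} {g : X → H}
    (ha : MemLp a 2 μ) (hg : MemLp g 2 μ) : Integrable (fun x => a x • g x) μ :=
  memLp_one_iff_integrable.1 (hg.smul ha)

section Gradient

variable {H : Type*} [NormedAddCommGroup H] [InnerProductSpace ℝ H] [FiniteDimensional ℝ H]
  {X : Type*} [MeasurableSpace X] {μ : Measure X} {f : H → X → ℝ} {w : H}

/-- The gradient in the parameter is a limit of difference quotients, hence measurable in the other
variable. -/
theorem aestronglyMeasurable_gradient (hf : ∀ᶠ v in 𝓝 w, AEStronglyMeasurable (f v) μ)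
    (hd : ∀ᵐ x ∂μ, DifferentiableAt ℝ (fun v => f v x) w) :
    AEStronglyMeasurable (fun x => gradient (fun v => f v x) w) μ := by
  have hu : ∀ u : H, AEStronglyMeasurable (fun x => (inner ℝ (gradient (fun v => f v x) w) u : ℝ))
      μ := by
    intro u
    have hseq : Tendsto (fun n : ℕ => w + ((n : ℝ) + 1)⁻¹ • u) atTop (𝓝 w) := by
      have h0 : Tendsto (fun n : ℕ => ((n : ℝ) + 1)⁻¹) atTop (𝓝 0) := by
        simpa using tendsto_one_div_add_atTop_nhds_zero_nat (𝕜 := ℝ)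
      simpa using tendsto_const_nhds.add (h0.smul_const u)
    obtain ⟨N, hN⟩ := eventually_atTop.1 (hseq.eventually hf)
    refine aestronglyMeasurable_of_tendsto_ae atTop (f := fun (n : ℕ) x =>
      (((n + N : ℕ) : ℝ) + 1) * (f (w + (((n + N : ℕ) : ℝ) + 1)⁻¹ • u) x - f w x)) ?_ ?_
    · intro n
      exact ((hN (n + N) (Nat.le_add_left _ _)).sub hf.self_of_nhds).const_mul _
    · filter_upwards [hd] with x hx
      have h1 := (hx.hasGradientAt.hasFDerivAt.lim_real u).comp
        (tendsto_atTop_add_const_right atTop (1 : ℝ)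
          (tendsto_natCast_atTop_atTop.comp (tendsto_add_atTop_nat N)))
      simpa [Function.comp_def] using h1
  have hsum : ∀ x, gradient (fun v => f v x) w = ∑ i, (inner ℝ (gradient (fun v => f v x) w)
      (stdOrthonormalBasis ℝ H i) : ℝ) • stdOrthonormalBasis ℝ H i := by
    intro x
    conv_lhs => rw [← (stdOrthonormalBasis ℝ H).sum_repr' (gradient (fun v => f v x) w)]
    simp only [real_inner_comm]
  rw [show (fun x => gradient (fun v => f v x) w) = fun x => ∑ i,
    (inner ℝ (gradient (fun v => f v x) w) (stdOrthonormalBasis ℝ H i) : ℝ) •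
      stdOrthonormalBasis ℝ H i from funext hsum]
  exact Finset.aestronglyMeasurable_fun_sum _ fun i _ => (hu _).smul_const _

/-- The squared loss `v ↦ ∫ (f v x - p x)²` is differentiable at `w` with the expected gradient when
`f` is Lipschitz at `w` in `L²` and differentiable at `w` almost everywhere: the remainders of the
first-order expansions of `f`, divided by `‖v - w‖`, tend weakly to `0`. -/
theorem hasGradientAt_integral_sub_sq [IsFiniteMeasure μ] (hf : ∀ᶠ v in 𝓝 w, MemLp (f v) 2 μ)
    (hd : ∀ᵐ x ∂μ, DifferentiableAt ℝ (fun v => f v x) w)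
    {K : ℝ} (hK : ∀ᶠ v in 𝓝 w, ∫ x, (f v x - f w x) ^ 2 ∂μ ≤ K * ‖v - w‖ ^ 2)
    (hg : MemLp (fun x => gradient (fun v => f v x) w) 2 μ) {p : X → ℝ} (hp : MemLp p 2 μ) :
    HasGradientAt (fun v => ∫ x, (f v x - p x) ^ 2 ∂μ)
      ((2 : ℝ) • ∫ x, (f w x - p x) • gradient (fun v => f v x) w ∂μ) w := by
  set g := fun x => gradient (fun v => f v x) w with hgdef
  have hfw : MemLp (f w) 2 μ := hf.self_of_nhds
  have hh : MemLp (fun x => f w x - p x) 2 μ := hfw.sub hp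
  have hhg : Integrable (fun x => (f w x - p x) • g x) μ := hh.integrable_smul_of_two hg
  set R : H → X → ℝ := fun v x => ‖v - w‖⁻¹ * (f v x - f w x - inner ℝ (g x) (v - w)) with hR
  have hgu : ∀ u : H, MemLp (fun x => (inner ℝ (g x) u : ℝ)) 2 μ := fun u => hg.inner_const u
  have hRmem : ∀ v, MemLp (f v) 2 μ → MemLp (R v) 2 μ := fun v hv =>
    ((hv.sub hfw).sub (hgu _)).const_mul _
  have hRlim : ∀ᵐ x ∂μ, Tendsto (fun v => R v x) (𝓝 w) (𝓝 0) := by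
    filter_upwards [hd] with x hx
    have h1 := (hasGradientAt_iff_isLittleO.1 hx.hasGradientAt).norm_right.tendsto_div_nhds_zero
    refine h1.congr fun v => ?_
    simp only [hR, hgdef]
    ring
  -- the error term of the expansion, divided by `‖v - w‖`
  have hexp : ∀ v, MemLp (f v) 2 μ →
      (∫ x, (f v x - p x) ^ 2 ∂μ - ∫ x, (f w x - p x) ^ 2 ∂μ -
        inner ℝ ((2 : ℝ) • ∫ x, (f w x - p x) • g x ∂μ) (v - w)) / ‖v - w‖ =
      ‖v - w‖⁻¹ * ∫ x, (f v x - f w x) ^ 2 ∂μ + 2 * ∫ x, R v x * (f w x - p x) ∂μ := by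
    intro v hv
    have i1 : Integrable (fun x => (f v x - p x) ^ 2) μ := (hv.sub hp).integrable_sq
    have i2 : Integrable (fun x => (f w x - p x) ^ 2) μ := hh.integrable_sq
    have i12 : Integrable (fun x => (f v x - p x) ^ 2 - (f w x - p x) ^ 2) μ := i1.sub i2
    have i3 : Integrable (fun x => (f v x - f w x) ^ 2) μ := (hv.sub hfw).integrable_sq
    have i4 : Integrable (fun x => R v x * (f w x - p x)) μ := (hRmem v hv).integrable_mul hh
    have i5 : Integrable (fun x => (inner ℝ (g x) (v - w) : ℝ) * (f w x - p x)) μ :=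
      (hgu _).integrable_mul hh
    have e1 : inner ℝ ((2 : ℝ) • ∫ x, (f w x - p x) • g x ∂μ) (v - w) =
        2 * ∫ x, (inner ℝ (g x) (v - w) : ℝ) * (f w x - p x) ∂μ := by
      rw [inner_smul_left, real_inner_comm, ← integral_inner hhg]
      simp only [inner_smul_right, conj_trivial]
      congr 1
      refine integral_congr_ae (Eventually.of_forall fun x => ?_)
      simp only [real_inner_comm (v - w)]
      ring
    rw [e1, ← integral_const_mul, ← integral_const_mul, ← integral_const_mul,
      ← integral_sub i1 i2, ← integral_sub i12 (i5.const_mul 2),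
      ← integral_add (i3.const_mul _) (i4.const_mul 2), ← integral_div]
    refine integral_congr_ae (Eventually.of_forall fun x => ?_)
    simp only [hR]
    ring
  rw [hasGradientAt_iff_isLittleO, ← Asymptotics.isLittleO_norm_right,
    Asymptotics.isLittleO_iff_tendsto (by
      intro v hv
      have : v = w := by simpa [sub_eq_zero] using hv
      simp [this])]
  have hmain : Tendsto (fun v => ‖v - w‖⁻¹ * ∫ x, (f v x - f w x) ^ 2 ∂μ +
      2 * ∫ x, R v x * (f w x - p x) ∂μ) (𝓝 w) (𝓝 (0 + 2 * 0)) := by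
    have hn : Tendsto (fun v => ‖v - w‖) (𝓝 w) (𝓝 0) := by
      have : Continuous fun v : H => ‖v - w‖ := by fun_prop
      simpa using this.tendsto w
    refine Tendsto.add ?_ (Tendsto.const_mul 2 ?_)
    · refine squeeze_zero' (g := fun v => K * ‖v - w‖) (Eventually.of_forall fun v => ?_) ?_
        (by simpa using hn.const_mul K)
      · have : 0 ≤ ∫ x, (f v x - f w x) ^ 2 ∂μ := integral_nonneg fun x => sq_nonneg _
        positivity
      · filter_upwards [hK] with v hv
        rcases eq_or_ne ‖v - w‖ 0 with h0 | h0
        · simp [h0]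
        · calc _ ≤ ‖v - w‖⁻¹ * (K * ‖v - w‖ ^ 2) := by gcongr
            _ = _ := by field_simp
    · refine tendsto_of_seq_tendsto fun v hv => ?_
      obtain ⟨N, hN⟩ := eventually_atTop.1 (hv.eventually (hf.and hK))
      refine (tendsto_add_atTop_iff_nat N).1 ?_
      have hGint : Integrable (fun x => ‖g x‖ ^ 2) μ := hg.norm.integrable_sq
      -- `R ^ 2 ≤ 2 * ‖v - w‖⁻¹ ^ 2 * (f v - f w) ^ 2 + 2 * ‖g‖ ^ 2` gives the bound in `L²`
      refine tendsto_integral_mul_of_bounded_of_tendsto_ae hh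
        (fun n => hRmem _ (hN (n + N) (Nat.le_add_left _ _)).1)
        (C := 2 * |K| + 2 * ∫ x, ‖g x‖ ^ 2 ∂μ) (fun n => ?_) ?_
      · obtain ⟨h1, h2⟩ := hN (n + N) (Nat.le_add_left _ _)
        set y := v (n + N) with hy
        have i3 : Integrable (fun x => (f y x - f w x) ^ 2) μ := (h1.sub hfw).integrable_sq
        calc ∫ x, R y x ^ 2 ∂μ
            ≤ ∫ x, (2 * ‖y - w‖⁻¹ ^ 2 * (f y x - f w x) ^ 2 + 2 * ‖g x‖ ^ 2) ∂μ := by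
              refine integral_mono_of_nonneg (Eventually.of_forall fun x => sq_nonneg _)
                ((i3.const_mul _).add (hGint.const_mul 2)) (Eventually.of_forall fun x => ?_)
              have e1 : (‖y - w‖⁻¹ * inner ℝ (g x) (y - w)) ^ 2 ≤ ‖g x‖ ^ 2 := by
                refine sq_le_sq' ?_ ?_ <;> rcases eq_or_ne ‖y - w‖ 0 with h0 | h0
                · simp [h0]
                · have := neg_le_of_abs_le (abs_real_inner_le_norm (g x) (y - w))
                  rw [inv_mul_eq_div, le_div_iff₀ (by positivity)]
                  linarith
                · simp [h0]
                · have := real_inner_le_norm (g x) (y - w)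
                  rwa [inv_mul_eq_div, div_le_iff₀ (by positivity)]
              simp only [hR]
              nlinarith [sq_nonneg (‖y - w‖⁻¹ * (f y x - f w x) +
                ‖y - w‖⁻¹ * inner ℝ (g x) (y - w))]
          _ = 2 * (‖y - w‖⁻¹ ^ 2 * ∫ x, (f y x - f w x) ^ 2 ∂μ) + 2 * ∫ x, ‖g x‖ ^ 2 ∂μ := by
              rw [integral_add (i3.const_mul _) (hGint.const_mul 2), integral_const_mul,
                integral_const_mul]
              ring
          _ ≤ _ := by
              gcongr
              rcases eq_or_ne ‖y - w‖ 0 with h0 | h0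
              · simp [h0]
              · calc _ ≤ ‖y - w‖⁻¹ ^ 2 * (K * ‖y - w‖ ^ 2) := by gcongr
                  _ = K := by field_simp
                  _ ≤ |K| := le_abs_self K
      · filter_upwards [hRlim] with x hx
        exact hx.comp ((tendsto_add_atTop_iff_nat N).2 hv)
  rw [zero_add, mul_zero] at hmain
  refine hmain.congr' ?_
  filter_upwards [hf] with v hv
  exact (hexp v hv).symm

end Gradient

/-! ### The variance of the gradient -/

theorem LocallyBoundedVariationOn.measurable {ψ : ℝ → ℝ}
    (h : LocallyBoundedVariationOn ψ Set.univ) : Measurable ψ := by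
  obtain ⟨p, q, hp, hq, rfl⟩ := h.exists_monotoneOn_sub_monotoneOn
  exact (monotoneOn_univ.1 hp).measurable.sub (monotoneOn_univ.1 hq).measurable

theorem EuclideanSpace.enorm_sq_eq_sum {m : ℕ} (v : EuclideanSpace ℝ (Fin m)) :
    ‖v‖ₑ ^ 2 = ∑ j, ‖v j‖ₑ ^ 2 := by
  simp only [← ofReal_norm]
  rw [← ENNReal.ofReal_pow (norm_nonneg _), EuclideanSpace.norm_sq_eq,
    ENNReal.ofReal_sum_of_nonneg fun _ _ => sq_nonneg _]
  exact Finset.sum_congr rfl fun j _ => ENNReal.ofReal_pow (norm_nonneg _) 2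

theorem ENNReal.add_sq_le_two_mul (a b : ℝ≥0∞) : (a + b) ^ 2 ≤ 2 * (a ^ 2 + b ^ 2) := by
  rcases eq_or_ne a ∞ with rfl | ha
  · simp
  rcases eq_or_ne b ∞ with rfl | hb
  · simp
  lift a to ℝ≥0 using ha
  lift b to ℝ≥0 using hb
  exact_mod_cast add_sq_le (a := a) (b := b)

theorem lintegral_enorm_sub_integral_sq_le {Ω H : Type*} [MeasurableSpace Ω] {σ : Measure Ω}
    [IsProbabilityMeasure σ] [NormedAddCommGroup H] [NormedSpace ℝ H] {V : Ω → H}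
    (hV : AEStronglyMeasurable V σ) :
    ∫⁻ ω, ‖V ω - ∫ τ, V τ ∂σ‖ₑ ^ 2 ∂σ ≤ 4 * ∫⁻ ω, ‖V ω‖ₑ ^ 2 ∂σ := by
  have h1 : ‖∫ τ, V τ ∂σ‖ₑ ^ 2 ≤ ∫⁻ ω, ‖V ω‖ₑ ^ 2 ∂σ :=
    (pow_le_pow_left' (enorm_integral_le_lintegral_enorm V) 2).trans
      (sq_lintegral_le_lintegral_sq hV.enorm)
  calc _ ≤ ∫⁻ ω, 2 * (‖V ω‖ₑ ^ 2 + ‖∫ τ, V τ ∂σ‖ₑ ^ 2) ∂σ := by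
        refine lintegral_mono fun ω => ?_
        exact (pow_le_pow_left' enorm_sub_le 2).trans (ENNReal.add_sq_le_two_mul _ _)
    _ = 2 * (∫⁻ ω, ‖V ω‖ₑ ^ 2 ∂σ + ‖∫ τ, V τ ∂σ‖ₑ ^ 2) := by
        rw [lintegral_const_mul' _ _ (by norm_num), lintegral_add_right _ measurable_const,
          lintegral_const, measure_univ, mul_one]
    _ ≤ 2 * (∫⁻ ω, ‖V ω‖ₑ ^ 2 ∂σ + ∫⁻ ω, ‖V ω‖ₑ ^ 2 ∂σ) := by gcongr
    _ = _ := by ring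

section Vector

variable {d m : ℕ} {ι : Type} {ε : ℝ → ℝ} {φ : EuclideanSpace ℝ (Fin d) → ℝ} {α : ι → ℝ}
  {φs : ι → EuclideanSpace ℝ (Fin d) → ℝ} {ψ : ℝ → ℝ}
  {g : EuclideanSpace ℝ (Fin d) → EuclideanSpace ℝ (Fin m)}

theorem memLp_comp_inner_sub {μ : Measure (EuclideanSpace ℝ (Fin d))} [IsFiniteMeasure μ]
    (hψ : Measurable ψ) (hb : ∀ t, |ψ t| ≤ 1) (w : EuclideanSpace ℝ (Fin d)) (c : ℝ) :
    MemLp (fun x => ψ (inner ℝ w x) - c) 2 μ := by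
  refine MemLp.of_bound ?_ (1 + |c|) (Eventually.of_forall fun x => ?_)
  · exact ((hψ.comp (by fun_prop : Measurable fun x : EuclideanSpace ℝ (Fin d) =>
      (inner ℝ w x : ℝ))).sub_const _).aestronglyMeasurable
  · rw [Real.norm_eq_abs]
    exact (abs_sub _ _).trans (by linarith [hb (inner ℝ w x)])

theorem integrable_comp_inner_smul {μ : Measure (EuclideanSpace ℝ (Fin d))} [IsFiniteMeasure μ]
    (hψ : Measurable ψ) (hb : ∀ t, |ψ t| ≤ 1) (hg : MemLp g 2 μ) (w : EuclideanSpace ℝ (Fin d))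
    (c : ℝ) : Integrable (fun x => (ψ (inner ℝ w x) - c) • g x) μ :=
  (memLp_comp_inner_sub hψ hb w c).integrable_smul_of_two hg

theorem integral_comp_inner_smul_apply {μ : Measure (EuclideanSpace ℝ (Fin d))}
    [IsFiniteMeasure μ] (hψ : Measurable ψ) (hb : ∀ t, |ψ t| ≤ 1) (hg : MemLp g 2 μ) (c : ℝ)
    (w : EuclideanSpace ℝ (Fin d)) (j : Fin m) :
    (∫ x, (ψ (inner ℝ w x) - c) • g x ∂μ) j =
      ∫ x, (ψ (inner ℝ w x) - c) * hg.1.mk g x j ∂μ := by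
  have h1 := (EuclideanSpace.proj (𝕜 := ℝ) j).integral_comp_comm
    (integrable_comp_inner_smul hψ hb hg w c)
  refine h1.symm.trans (integral_congr_ae ?_)
  filter_upwards [hg.1.ae_eq_mk] with x hx
  simp [hx]

theorem measurable_integral_comp_inner_smul {μ : Measure (EuclideanSpace ℝ (Fin d))}
    [IsFiniteMeasure μ] (hψ : Measurable ψ) (hb : ∀ t, |ψ t| ≤ 1) (hg : MemLp g 2 μ) (c : ℝ) :
    Measurable fun w => ∫ x, (ψ (inner ℝ w x) - c) • g x ∂μ := by
  refine (WithLp.measurable_toLp 2 (Fin m → ℝ)).comp (g := WithLp.toLp 2)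
    (f := fun w j => (∫ x, (ψ (inner ℝ w x) - c) • g x ∂μ) j) ?_
  refine measurable_pi_lambda _ fun j => ?_
  have hgm : Measurable fun x => hg.1.mk g x j :=
    (EuclideanSpace.proj (𝕜 := ℝ) j).measurable.comp hg.1.stronglyMeasurable_mk.measurable
  simp only [integral_comp_inner_smul_apply hψ hb hg]
  exact measurable_integral_comp_inner hψ hgm c

theorem IsFourierMixture.lintegral_enorm_integral_smul_sq_le [NeZero d]
    (h : IsFourierMixture ε φ α φs) (hg : MemLp g 2 (sqDensityMeasure φ)) {r : ℝ} (hr : 0 ≤ r)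
    (hψ : Measurable ψ) (hb : ∀ t, |ψ t| ≤ 1) (hper : Function.Periodic ψ 1) :
    ∫⁻ w, ‖∫ x, (ψ (inner ℝ w x) - periodMean ψ) • g x ∂(sqDensityMeasure φ)‖ₑ ^ 2
        ∂(uniformSphere d (2 * r)) ≤
      8 * (ENNReal.ofReal (ε r) ^ 2 + 2 * ENNReal.ofReal (√(1 / 2) ^ d)) *
        ∫⁻ x, ‖g x‖ₑ ^ 2 ∂(sqDensityMeasure φ) := by
  have := h.density.isProbabilityMeasure
  have hgm : ∀ j, Measurable fun x => hg.1.mk g x j := fun j =>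
    (EuclideanSpace.proj (𝕜 := ℝ) j).measurable.comp hg.1.stronglyMeasurable_mk.measurable
  have hgsum : ∫⁻ x, ‖g x‖ₑ ^ 2 ∂(sqDensityMeasure φ) =
      ∑ j, ∫⁻ x, ‖hg.1.mk g x j‖ₑ ^ 2 ∂(sqDensityMeasure φ) := by
    rw [← lintegral_finsetSum _ fun j _ => (hgm j).enorm.pow_const 2]
    refine lintegral_congr_ae ?_
    filter_upwards [hg.1.ae_eq_mk] with x hx
    rw [hx, EuclideanSpace.enorm_sq_eq_sum]
  have hgfin : ∫⁻ x, ‖g x‖ₑ ^ 2 ∂(sqDensityMeasure φ) ≠ ∞ := by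
    have h1 := eLpNorm_nnreal_pow_eq_lintegral (μ := sqDensityMeasure φ) (f := g) (p := 2)
      (by norm_num)
    have h2 : eLpNorm g 2 (sqDensityMeasure φ) ^ 2 =
      ∫⁻ x, ‖g x‖ₑ ^ 2 ∂(sqDensityMeasure φ) := by simpa using h1
    rw [← h2]
    exact ENNReal.pow_ne_top hg.2.ne
  simp only [EuclideanSpace.enorm_sq_eq_sum (∫ x, _ ∂_),
    integral_comp_inner_smul_apply hψ hb hg]
  rw [lintegral_finsetSum _ fun j _ =>
    (measurable_integral_comp_inner hψ (hgm j) _).enorm.pow_const 2, hgsum, Finset.mul_sum]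
  refine Finset.sum_le_sum fun j _ => h.lintegral_correlation_sq_le (hgm j) ?_ hr hψ hb hper
  refine ne_top_of_le_ne_top hgfin ?_
  rw [hgsum]
  exact Finset.single_le_sum
    (f := fun j => ∫⁻ x, ‖hg.1.mk g x j‖ₑ ^ 2 ∂(sqDensityMeasure φ)) (fun _ _ => zero_le)
    (Finset.mem_univ j)

end Vector

theorem sqrt_half_pow_eq_exp (d : ℕ) : √(1 / 2) ^ d = Real.exp (-(Real.log 2 / 2) * d) := by
  have h : √(1 / 2) = Real.exp (-(Real.log 2 / 2)) := by
    rw [← Real.exp_log (show 0 < √(1 / 2 : ℝ) by positivity), Real.log_sqrt (by norm_num), one_div,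
      Real.log_inv]
    congr 1
    ring
  rw [h, ← Real.exp_nat_mul, mul_comm]

theorem theorem3 :
    ∃ c₁ c₂ c₃ : ℝ, 0 < c₁ ∧ 0 < c₂ ∧ 0 < c₃ ∧
      ∀ (d m : ℕ), c₁ ≤ (d : ℝ) →
      -- the periodic function
      ∀ (ψ : ℝ → ℝ), (∀ t, ψ t ∈ Set.Icc (-1 : ℝ) 1) → Function.Periodic ψ 1 →
        LocallyBoundedVariationOn ψ Set.univ →
      -- the input distribution
      ∀ (ε : ℝ → ℝ), (∀ s, 0 ≤ s → ε s ∈ Set.Icc (0 : ℝ) 1) →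
      ∀ (ι : Type) (φ : EuclideanSpace ℝ (Fin d) → ℝ) (α : ι → ℝ)
        (φs : ι → EuclideanSpace ℝ (Fin d) → ℝ), IsFourierMixture ε φ α φs →
      -- the predictors `x ↦ f v x`, for `v` in the parameter domain `W`, and the fixed point `w`
      ∀ (W : Set (EuclideanSpace ℝ (Fin m)))
        (f : EuclideanSpace ℝ (Fin m) → EuclideanSpace ℝ (Fin d) → ℝ),
        (∀ v ∈ W, MemLp (f v) 2 (sqDensityMeasure φ)) →
      ∀ w ∈ interior W,
        (∀ᵐ x ∂(sqDensityMeasure φ), DifferentiableAt ℝ (fun v => f v x) w) →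
        (∃ K : ℝ, ∀ᶠ v in 𝓝 w,
          ∫ x, (f v x - f w x) ^ 2 ∂(sqDensityMeasure φ) ≤ K * ‖v - w‖ ^ 2) →
      ∀ G : ℝ≥0,
        ∫⁻ x, ‖gradient (fun v => f v x) w‖ₑ ^ 2 ∂(sqDensityMeasure φ) ≤ G →
      ∀ r : ℝ, 0 ≤ r →
        (∀ wstar, DifferentiableAt ℝ (objective φ ψ f wstar) w) ∧
        Integrable (fun wstar => gradient (objective φ ψ f wstar) w) (uniformSphere d (2 * r)) ∧
        ∫⁻ wstar, ‖gradient (objective φ ψ f wstar) w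
            - ∫ ustar, gradient (objective φ ψ f ustar) w ∂(uniformSphere d (2 * r))‖ₑ ^ 2
          ∂(uniformSphere d (2 * r))
        ≤ ENNReal.ofReal c₂ * G *
          (ENNReal.ofReal (Real.exp (-c₃ * d))
            + ∑' n : ℕ, ENNReal.ofReal (ε (((n : ℝ) + 1) * r))) := by
  refine ⟨1, 256, Real.log 2 / 2, one_pos, by norm_num, by positivity, ?_⟩
  intro d m hd ψ hψI hper hBV ε hε ι φ α φs hmix W f hf w hw hdiff hK G hG r hr
  have hd0 : NeZero d := ⟨by rintro rfl; norm_num at hd⟩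
  have hprob := hmix.density.isProbabilityMeasure
  have hψ : Measurable ψ := hBV.measurable
  have hb : ∀ t, |ψ t| ≤ 1 := fun t => abs_le.2 (hψI t)
  obtain ⟨K, hK⟩ := hK
  set μ := sqDensityMeasure φ with hμ
  set σ := uniformSphere d (2 * r) with hσ
  set g := fun x => gradient (fun v => f v x) w with hgdef
  have hfev : ∀ᶠ v in 𝓝 w, MemLp (f v) 2 μ := by
    filter_upwards [mem_interior_iff_mem_nhds.1 hw] with v hv
    exact hf v hv
  have hfw : MemLp (f w) 2 μ := hfev.self_of_nhds
  have hgm : AEStronglyMeasurable g μ :=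
    aestronglyMeasurable_gradient (hfev.mono fun v hv => hv.1) hdiff
  have hg : MemLp g 2 μ := by
    refine ⟨hgm, ?_⟩
    have h1 := eLpNorm_nnreal_pow_eq_lintegral (μ := μ) (f := g) (p := 2) (by norm_num)
    have h2 : eLpNorm g 2 μ ^ 2 = ∫⁻ x, ‖g x‖ₑ ^ 2 ∂μ := by simpa using h1
    refine lt_top_iff_ne_top.2 fun htop => ?_
    rw [htop, ENNReal.top_pow two_ne_zero] at h2
    exact (hG.trans_lt ENNReal.coe_lt_top).ne h2.symm
  have hp : ∀ u : EuclideanSpace ℝ (Fin d), MemLp (fun x => ψ (inner ℝ u x)) 2 μ := fun u => by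
    simpa using memLp_comp_inner_sub (μ := μ) hψ hb u 0
  have hgrad : ∀ u, HasGradientAt (objective φ ψ f u)
      ((2 : ℝ) • ∫ x, (f w x - ψ (inner ℝ u x)) • g x ∂μ) w := fun u =>
    hasGradientAt_integral_sub_sq hfev hdiff hK hg (hp u)
  -- up to a constant, the gradient is a multiple of the correlation vector `V`
  set V : EuclideanSpace ℝ (Fin d) → EuclideanSpace ℝ (Fin m) := fun u =>
    ∫ x, (ψ (inner ℝ u x) - periodMean ψ) • g x ∂μ with hV
  set A : EuclideanSpace ℝ (Fin m) := (2 : ℝ) • ∫ x, (f w x - periodMean ψ) • g x ∂μ with hA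
  have hgradV : (fun u => gradient (objective φ ψ f u) w) = fun u => A - (2 : ℝ) • V u := by
    funext u
    have hfc : MemLp (fun x => f w x - periodMean ψ) 2 μ := hfw.sub (memLp_const _)
    have i1 : Integrable (fun x => (f w x - periodMean ψ) • g x) μ :=
      hfc.integrable_smul_of_two hg
    rw [(hgrad u).gradient, hA, hV, ← smul_sub, ← integral_sub i1
      (integrable_comp_inner_smul hψ hb hg u _)]
    congr 1
    refine integral_congr_ae (Eventually.of_forall fun x => ?_)
    simp only [← sub_smul]
    congr 1
    ring
  have hVm : Measurable V := measurable_integral_comp_inner_smul hψ hb hg _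
  have hVint : Integrable V σ := by
    refine Integrable.of_bound hVm.aestronglyMeasurable (∫ x, 2 * ‖g x‖ ∂μ)
      (Eventually.of_forall fun u => ?_)
    have hgi : Integrable g μ := hg.integrable (by norm_num)
    refine norm_integral_le_of_norm_le (hgi.norm.const_mul 2) (Eventually.of_forall fun x => ?_)
    rw [norm_smul, Real.norm_eq_abs]
    gcongr
    exact (abs_sub _ _).trans (by linarith [hb (inner ℝ u x), abs_periodMean_le hb])
  have hVint2 : Integrable (fun u => (2 : ℝ) • V u) σ := hVint.smul (2 : ℝ)
  have hint : Integrable (fun u => A - (2 : ℝ) • V u) σ := (integrable_const A).sub hVint2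
  refine ⟨fun u => (hgrad u).differentiableAt, by rw [hgradV]; exact hint, ?_⟩
  have hmean : ∫ u, gradient (objective φ ψ f u) w ∂σ = A - (2 : ℝ) • ∫ u, V u ∂σ := by
    have e1 : ∫ u, (2 : ℝ) • V u ∂σ = (2 : ℝ) • ∫ u, V u ∂σ := integral_smul _ _
    have e2 : ∫ _, A ∂σ = A := by rw [integral_const, probReal_univ, one_smul]
    rw [hgradV, integral_sub (integrable_const A) hVint2, e1, e2]
  have hpt : ∀ u, ‖gradient (objective φ ψ f u) w - ∫ v, gradient (objective φ ψ f v) w ∂σ‖ₑ ^ 2 =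
      4 * ‖V u - ∫ v, V v ∂σ‖ₑ ^ 2 := by
    intro u
    have h1 : A - (2 : ℝ) • V u - (A - (2 : ℝ) • ∫ v, V v ∂σ) =
        (-2 : ℝ) • (V u - ∫ v, V v ∂σ) := by module
    have h2 : ‖(-2 : ℝ)‖ₑ = 2 := by rw [enorm_neg]; simp [Real.enorm_eq_ofReal]
    rw [hmean, congrFun hgradV u, h1, enorm_smul, mul_pow, h2]
    norm_num
  have hεr := hε r hr
  have hε1 : ENNReal.ofReal (ε r) ^ 2 ≤ ∑' n : ℕ, ENNReal.ofReal (ε (((n : ℝ) + 1) * r)) := by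
    have h1 : ENNReal.ofReal (ε r) ≤ 1 := by
      simpa using ENNReal.ofReal_le_ofReal hεr.2
    calc ENNReal.ofReal (ε r) ^ 2 ≤ ENNReal.ofReal (ε r) :=
          pow_le_of_le_one zero_le h1 two_ne_zero
      _ ≤ _ := by
        have := ENNReal.le_tsum (f := fun n : ℕ => ENNReal.ofReal (ε (((n : ℝ) + 1) * r))) 0
        simpa using this
  simp only [hpt]
  rw [lintegral_const_mul' _ _ (by norm_num)]
  set S := ∑' n : ℕ, ENNReal.ofReal (ε (((n : ℝ) + 1) * r)) with hS
  set q := ENNReal.ofReal (Real.exp (-(Real.log 2 / 2) * d)) with hq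
  calc 4 * ∫⁻ u, ‖V u - ∫ v, V v ∂σ‖ₑ ^ 2 ∂σ
      ≤ 4 * (4 * ∫⁻ u, ‖V u‖ₑ ^ 2 ∂σ) := by
        gcongr
        exact lintegral_enorm_sub_integral_sq_le hVint.1
    _ ≤ 4 * (4 * (8 * (ENNReal.ofReal (ε r) ^ 2 + 2 * q) * ∫⁻ x, ‖g x‖ₑ ^ 2 ∂μ)) := by
        gcongr
        rw [hq, ← sqrt_half_pow_eq_exp]
        exact hmix.lintegral_enorm_integral_smul_sq_le hg hr hψ hb hper
    _ ≤ 4 * (4 * (8 * (2 * S + 2 * q) * G)) := by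
        gcongr
        refine hε1.trans ?_
        rw [two_mul]
        exact le_self_add
    _ = ENNReal.ofReal 256 * G * (q + S) := by
        rw [show ENNReal.ofReal 256 = 256 by simp]
        ring
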